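/- **Setting.** Fix $n\ge 0$ and a Hessenberg function $h\colon[n]\to[n]$, that is, $i\le h(i)$ for all $i$ and $h(i)\le h(j)$ for $i\le j$. Let $\mathbf L=(L_1,\dots,L_n)$ and $\mathbf R=(R_1,\dots,R_n)$ be indeterminates, let $S(\mathbf L)$ be the group of permutations of $\mathbf L$, and let $\mathcal T=\prod_{\beta}\mathbb C[\mathbf L]$, the product being over all bijections $\beta\colon\mathbf R\to\mathbf L$; write $\mathbf 1_\beta$ for the idempotents. $\mathbb C[\mathbf L]$ is embedded diagonally in $\mathcal T$, and $\mathbb C[\mathbf R]$ is embedded by letting $R_i$ act on the coordinate $\beta$ as $\beta(R_i)$; thus every $x\in\mathcal T$ can be written uniquely as $x=\sum_\beta \mathbf 1_\beta\,g_\beta(\mathbf R)$. Let $\mathcal T_h\subseteq\mathcal T$ be the subring of those $x$ for which $R_i-R_j$ divides $g_\beta-g_{\beta\circ(R_i\leftrightarrow R_j)}$ for all $\beta$ and all $i<j\le h(i)$. It contains $\mathbb C[\mathbf L]$ and $\mathbb C[\mathbf R]$, it is graded by the polynomial degree of the coordinates, and it is stable under the dot action of $S(\mathbf L)$, $w\cdot(f\,\mathbf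 1_\beta)=w(f)\,\mathbf 1_{w\circ\beta}$. For $A=\mathbb C[\mathbf L]$ or $A=\mathbb C[\mathbf R]$ and a homogeneous $A$-basis $(e_i)$ of $\mathcal T_h$, put $$\mathrm{tr}_q(w,\mathcal T_h,A)=\sum_i q^{\deg e_i}\,(\text{coefficient of } e_i \text{ in } w\cdot e_i),\qquad \mathrm{frob}_q(S(\mathbf L),\mathcal T_h,A)=\frac1{n!}\sum_{w\in S(\mathbf L)}\mathrm{tr}_q(w,\mathcal T_h,A)\,p_{\text{cycle type of }w},$$ an element of the Hopf algebra $\mathrm{Sym}$ of symmetric functions over $\mathbb C(q)$, in which the power sums $p_k$ ($k\ge1$) are primitive. Let $E_t$ be the Hopf endomorphism of $\mathrm{Sym}$ with $E_t(p_k)=t^kp_k$, let $S$ be the antipode, so that $S(p_k)=-p_k$, and let $*$ be the convolution product. **Statement.** 1. $\mathcal T_h$ is free of rank $n!$, with a homogeneous basis, both over $\mathbb C[\mathbf L]$ and over $\mathbb C[\mathbf R]$. 2. The map $\mathrm{id}*(S\circ E_q)$ is a Hopf endomorphism of $\mathrm{Sym}$, and it sends $p_k$ to $(1-q^k)p_k$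 for every $k\ge 1$. 3. Whichever homogeneous bases are used to compute the two sides, $$E_{(1-q)}\bigl(\mathrm{frob}_q(S(\mathbf L),\mathcal T_h,\mathbb C[\mathbf L])\bigr)=\bigl(\mathrm{id}*(S\circ E_q)\bigr)\bigl(\mathrm{frob}_q(S(\mathbf L),\mathcal T_h,\mathbb C[\mathbf R])\bigr).$$ Equivalently, $\mathrm{frob}_q(S(\mathbf L),\mathcal T_h,\mathbb C[\mathbf L])$ is the image of $\mathrm{frob}_q(S(\mathbf L),\mathcal T_h,\mathbb C[\mathbf R])$ under the Hopf endomorphism of $\mathrm{Sym}$ with $p_k\mapsto\frac{1-q^k}{(1-q)^k}\,p_k$. -/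

import Mathlib

open scoped TensorProduct

noncomputable section

/-! ### Symmetric functions -/

/-- The `K`-algebra `Sym` of symmetric functions: formal power series of bounded degree in
countably many indeterminates which are invariant under all permutations of the indeterminates. -/
def SymFun (K : Type*) [Field K] : Subalgebra K (MvPowerSeries ℕ K) where
  carrier := {f | (∀ σ : Equiv.Perm ℕ, MvPowerSeries.rename σ f = f) ∧
    ∃ d : ℕ, ∀ m : ℕ →₀ ℕ, d < m.degree → MvPowerSeries.coeff m f = 0}
  mul_mem' := by
    rintro f g ⟨hf, d, hd⟩ ⟨hg, e, he⟩
    refine ⟨fun σ => by rw [map_mul, hf, hg], d + e, fun m hm => ?_⟩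
    classical
    rw [MvPowerSeries.coeff_mul]
    refine Finset.sum_eq_zero fun x hx => ?_
    have h1 : m.degree = x.1.degree + x.2.degree := by
      rw [← Finset.HasAntidiagonal.mem_antidiagonal.1 hx, map_add]
    rcases lt_or_ge d x.1.degree with h | h
    · rw [hd _ h, zero_mul]
    · rw [he _ (by omega), mul_zero]
  add_mem' := by
    rintro f g ⟨hf, d, hd⟩ ⟨hg, e, he⟩
    refine ⟨fun σ => by rw [map_add, hf, hg], d + e, fun m hm => ?_⟩
    rw [map_add, hd m (by omega), he m (by omega), add_zero]
  algebraMap_mem' := by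
    intro r
    refine ⟨fun σ => AlgHom.commutes _ r, 0, fun m hm => ?_⟩
    classical
    rw [MvPowerSeries.algebraMap_apply, MvPowerSeries.coeff_C, if_neg]
    rintro rfl
    simp at hm

namespace SymFun

section Power

variable (K : Type*) [Field K]

open Classical in
/-- The formal power series `∑ᵢ xᵢ ^ k` (used for `1 ≤ k`). -/
def psumSeries (k : ℕ) : MvPowerSeries ℕ K := 
  fun m => if ∃ i, m = Finsupp.single i k then 1 else 0

open Classical in
theorem coeff_psumSeries (k : ℕ) (m : ℕ →₀ ℕ) :
    MvPowerSeries.coeff m (psumSeries K k) = if ∃ i, m = Finsupp.single i k then 1 else 0 :=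
  rfl

theorem coeff_perm (f : MvPowerSeries ℕ K) (σ : Equiv.Perm ℕ) (m : ℕ →₀ ℕ) :
    MvPowerSeries.coeff (m.mapDomain σ) (MvPowerSeries.rename σ f) = MvPowerSeries.coeff m f := by
  have := MvPowerSeries.coeff_embDomain_rename σ.toEmbedding f m
  rwa [Finsupp.embDomain_eq_mapDomain] at this

theorem psumSeries_mem (k : ℕ) : psumSeries K k ∈ SymFun K := by
  classical
  refine ⟨fun σ => ?_, k, fun m hm => ?_⟩
  · ext m
    obtain ⟨m, rfl⟩ : ∃ m', Finsupp.mapDomain σ m' = m :=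
      ⟨m.mapDomain σ.symm, by rw [← Finsupp.mapDomain_comp]; simp⟩
    rw [coeff_perm, coeff_psumSeries, coeff_psumSeries]
    congr 1
    apply propext
    constructor
    · rintro ⟨i, rfl⟩
      exact ⟨σ i, by rw [Finsupp.mapDomain_single]⟩
    · rintro ⟨i, hi⟩
      refine ⟨σ.symm i, Finsupp.mapDomain_injective σ.injective ?_⟩
      rw [hi, Finsupp.mapDomain_single, σ.apply_symm_apply]
  · rw [coeff_psumSeries, if_neg]
    rintro ⟨i, rfl⟩
    simp at hm

/-- The power-sum symmetric function `p_(k) = ∑ᵢ xᵢ ^ k` (used for `1 ≤ k`). -/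
def p (k : ℕ) : SymFun K := ⟨psumSeries K k, psumSeries_mem K k⟩

/-- The algebra map from the polynomial ring in `P₀, P₁, …` sending `P_k` to `p_(k+1)`. -/
def ofPoly : MvPolynomial ℕ K →ₐ[K] SymFun K := MvPolynomial.aeval fun k => p K (k + 1)

/-- Restriction of a power series to the first `N` indeterminates. -/
def restr (N : ℕ) : MvPowerSeries ℕ K →ₐ[K] MvPowerSeries (Fin N) K :=
  MvPowerSeries.killCompl Fin.valEmbedding

theorem coeff_restr (N : ℕ) (f : MvPowerSeries ℕ K) (m : Fin N →₀ ℕ) :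
    MvPowerSeries.coeff m (restr K N f) =
      MvPowerSeries.coeff (m.embDomain Fin.valEmbedding) f :=
  MvPowerSeries.coeff_killCompl _ _

theorem restr_psum (N k : ℕ) (hk : k ≠ 0) :
    restr K N (psumSeries K k) = (MvPolynomial.psum (Fin N) K k : MvPowerSeries (Fin N) K) := by
  classical
  ext m
  rw [coeff_restr, coeff_psumSeries, MvPolynomial.coeff_coe, MvPolynomial.psum,
    MvPolynomial.coeff_sum]
  simp_rw [MvPolynomial.coeff_X_pow]
  by_cases h : ∃ i, m = Finsupp.single i k
  · obtain ⟨i, rfl⟩ := h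
    rw [if_pos ⟨i, by simp [Finsupp.embDomain_single]⟩, Finset.sum_eq_single i]
    · simp
    · intro j _ hj
      rw [if_neg]
      intro h
      exact hj (Finsupp.single_left_injective hk h)
    · simp
  · rw [if_neg, Finset.sum_eq_zero]
    · intro i _
      rw [if_neg]
      rintro rfl
      exact h ⟨i, rfl⟩
    · rintro ⟨i, hi⟩
      have hi' : i ∈ Set.range (Fin.valEmbedding (n := N)) := by
        by_contra hc
        have := Finsupp.embDomain_of_notMem_range (Fin.valEmbedding (n := N)) m i hc
        rw [hi] at this
        simp [hk] at this
      obtain ⟨j, rfl⟩ := hi'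
      refine h ⟨j, Finsupp.embDomain_injective Fin.valEmbedding ?_⟩
      rw [hi, Finsupp.embDomain_single]

/-- Symmetric functions of degree at most `N` are determined by their restriction. -/
theorem eq_zero_of_restr {N : ℕ} {f : MvPowerSeries ℕ K} (hf : f ∈ SymFun K)
    (hd : ∀ m : ℕ →₀ ℕ, N < m.degree → MvPowerSeries.coeff m f = 0)
    (h0 : restr K N f = 0) : f = 0 := by
  classical
  ext m
  rcases lt_or_ge N m.degree with h | h
  · rw [hd m h, map_zero]
  have hc : m.support.card ≤ N := by
    refine le_trans ?_ h
    rw [Finsupp.degree_apply, Finset.card_eq_sum_ones]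
    exact Finset.sum_le_sum fun i hi => Nat.one_le_iff_ne_zero.2 (Finsupp.mem_support_iff.1 hi)
  obtain ⟨σ, hσ⟩ : ∃ σ : Equiv.Perm ℕ, ∀ i ∈ m.support, σ i < N := by
    obtain ⟨t, ht, htc⟩ := Finset.exists_subset_card_eq (s := Finset.range N)
      (n := m.support.card) (by simpa using hc)
    let e : {x // x ∈ m.support} ≃ {x // x ∈ t} := Finset.equivOfCardEq htc.symm
    obtain ⟨σ, hσ⟩ := Equiv.Perm.exists_extending_pair (f := fun x : {x // x ∈ m.support} => (x : ℕ))
      (g := fun x => (e x : ℕ)) Subtype.val_injective (Subtype.val_injective.comp e.injective)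
    refine ⟨σ, fun i hi => ?_⟩
    have := hσ ⟨i, hi⟩
    rw [this]
    exact Finset.mem_range.1 (ht (e ⟨i, hi⟩).2)
  have hm : m.mapDomain σ ∈ Set.range (Finsupp.embDomain (M := ℕ) (Fin.valEmbedding (n := N))) := by
    rw [Finsupp.mem_range_embDomain_iff]
    intro x hx
    obtain ⟨i, hi, rfl⟩ := Finset.mem_image.1 (Finsupp.mapDomain_support hx)
    exact ⟨⟨σ i, hσ i hi⟩, rfl⟩
  obtain ⟨m', hm'⟩ := hm
  rw [← coeff_perm K f σ m, hf.1 σ, ← hm', ← coeff_restr, h0, map_zero, map_zero]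

/-- The map sending the `i`-th indeterminate to the power sum of exponent `i + 1` in `N`
indeterminates. -/
def finPoly (N : ℕ) : MvPolynomial (Fin N) K →ₐ[K] MvPolynomial (Fin N) K :=
  MvPolynomial.aeval fun i => MvPolynomial.psum (Fin N) K (i + 1)

theorem restr_ofPoly (N : ℕ) (Q : MvPolynomial (Fin N) K) :
    restr K N (ofPoly K (MvPolynomial.rename Fin.val Q) : SymFun K) =
      (finPoly K N Q : MvPowerSeries (Fin N) K) := by
  have : ((restr K N).comp (SymFun K).val).comp ((ofPoly K).comp (MvPolynomial.rename Fin.val)) =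
      (MvPolynomial.coeToMvPowerSeries.algHom K).comp (finPoly K N) := by
    refine MvPolynomial.algHom_ext fun i => ?_
    simp only [AlgHom.comp_apply, MvPolynomial.rename_X, ofPoly, finPoly, MvPolynomial.aeval_X]
    rw [MvPolynomial.coeToMvPowerSeries.algHom_apply]
    exact restr_psum K N (i + 1) (Nat.succ_ne_zero _)
  have h := DFunLike.congr_fun this Q
  rw [AlgHom.comp_apply, AlgHom.comp_apply, AlgHom.comp_apply, AlgHom.comp_apply,
    MvPolynomial.coeToMvPowerSeries.algHom_apply] at h
  simpa using h

theorem finPoly_symm (N : ℕ) (Q : MvPolynomial (Fin N) K) :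
    finPoly K N Q ∈ MvPolynomial.symmetricSubalgebra (Fin N) K := by
  have h2 : finPoly K N Q ∈ (finPoly K N).range := ⟨Q, rfl⟩
  rw [finPoly, ← Algebra.adjoin_range_eq_range_aeval] at h2
  refine Algebra.adjoin_le ?_ h2
  rintro _ ⟨i, rfl⟩
  exact MvPolynomial.psum_isSymmetric (Fin N) K _

/-- A surjective endomorphism of a Noetherian ring is injective. -/
theorem injective_of_surjective_end {R : Type*} [CommRing R] [IsNoetherianRing R] (φ : R →+* R)
    (hφ : Function.Surjective φ) : Function.Injective φ := by
  have hmono : Monotone fun n : ℕ => RingHom.ker (φ ^ n) := by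
    refine monotone_nat_of_le_succ fun n x hx => ?_
    rw [RingHom.mem_ker] at hx ⊢
    rw [pow_succ', RingHom.mul_def, RingHom.comp_apply, hx, map_zero]
  obtain ⟨n, hn⟩ := monotone_stabilizes_iff_noetherian.2 ‹IsNoetherianRing R› ⟨_, hmono⟩
  rw [injective_iff_map_eq_zero]
  intro x hx
  have hsn : Function.Surjective (φ ^ n : R →+* R) := by
    rw [RingHom.coe_pow]
    exact hφ.iterate n
  obtain ⟨y, rfl⟩ := hsn x
  have h1 : y ∈ RingHom.ker (φ ^ (n + 1)) := by
    rw [RingHom.mem_ker, pow_succ', RingHom.mul_def, RingHom.comp_apply, hx]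
  have h2 := hn (n + 1) (Nat.le_succ n)
  have h3 : y ∈ RingHom.ker (φ ^ n) := by
    have : RingHom.ker (φ ^ n) = RingHom.ker (φ ^ (n + 1)) := h2
    rwa [this]
  exact h3

/-- Power series of degree at most `d`. -/
def Bounded (d : ℕ) (f : MvPowerSeries ℕ K) : Prop :=
  ∀ m : ℕ →₀ ℕ, d < m.degree → MvPowerSeries.coeff m f = 0

theorem bounded_monomial {N : ℕ} (s : Fin N →₀ ℕ) (r : K) :
    Bounded K (Finsupp.weight (fun i : Fin N => (i : ℕ) + 1) s)
      (ofPoly K (MvPolynomial.rename Fin.val (MvPolynomial.monomial s r)) : SymFun K) := by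
  classical
  have hmul : ∀ {a b : ℕ} {f g : MvPowerSeries ℕ K}, Bounded K a f → Bounded K b g →
      Bounded K (a + b) (f * g) := by
    intro a b f g hf hg m hm
    rw [MvPowerSeries.coeff_mul]
    refine Finset.sum_eq_zero fun x hx => ?_
    have h1 : m.degree = x.1.degree + x.2.degree := by
      rw [← Finset.HasAntidiagonal.mem_antidiagonal.1 hx, map_add]
    rcases lt_or_ge a x.1.degree with h | h
    · rw [hf _ h, zero_mul]
    · rw [hg _ (by omega), mul_zero]
  have hone : Bounded K 0 (1 : MvPowerSeries ℕ K) := by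
    intro m hm
    rw [MvPowerSeries.coeff_one, if_neg]
    rintro rfl
    simp at hm
  have hpow : ∀ {a : ℕ} {f : MvPowerSeries ℕ K} (c : ℕ), Bounded K a f →
      Bounded K (c * a) (f ^ c) := by
    intro a f c hf
    induction c with
    | zero => simpa using hone
    | succ c ih =>
      rw [pow_succ, add_mul, one_mul]
      exact hmul ih hf
  have hprod : ∀ t : Finset (Fin N), Bounded K (∑ i ∈ t, s i * ((i : ℕ) + 1))
      (∏ i ∈ t, psumSeries K ((i : ℕ) + 1) ^ s i) := by
    intro t
    induction t using Finset.induction_on with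
    | empty => simpa using hone
    | insert a t ha ih =>
      rw [Finset.sum_insert ha, Finset.prod_insert ha]
      refine hmul (hpow _ ?_) ih
      intro m hm
      rw [coeff_psumSeries, if_neg]
      rintro ⟨i, rfl⟩
      simp at hm
  have h1 : (ofPoly K (MvPolynomial.rename Fin.val (MvPolynomial.monomial s r)) : MvPowerSeries ℕ K)
      = r • ∏ i ∈ s.support, psumSeries K ((i : ℕ) + 1) ^ s i := by
    rw [ofPoly, MvPolynomial.aeval_rename, MvPolynomial.aeval_monomial, ← Algebra.smul_def,
      Finsupp.prod]
    simp [p]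
  rw [h1, Finsupp.weight_apply, Finsupp.sum]
  intro m hm
  rw [map_smul, hprod s.support m (by simpa using hm), smul_zero]

theorem homog_monomial {N : ℕ} (s : Fin N →₀ ℕ) (r : K) :
    (finPoly K N (MvPolynomial.monomial s r)).IsHomogeneous
      (Finsupp.weight (fun i : Fin N => (i : ℕ) + 1) s) := by
  rw [finPoly, MvPolynomial.aeval_monomial, Finsupp.weight_apply, Finsupp.sum, Finsupp.prod]
  rw [← zero_add (∑ i ∈ s.support, _)]
  refine (MvPolynomial.isHomogeneous_C _ r).mul (MvPolynomial.IsHomogeneous.prod _ _ _ ?_)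
  intro i _
  rw [smul_eq_mul, mul_comm]
  refine MvPolynomial.IsHomogeneous.pow ?_ _
  exact MvPolynomial.IsHomogeneous.sum _ _ _ fun j _ => MvPolynomial.isHomogeneous_X_pow j _

variable [CharZero K]

theorem esymm_mem_range (N k : ℕ) (hk : k ≤ N) :
    MvPolynomial.esymm (Fin N) K k ∈ (finPoly K N).range := by
  induction k using Nat.strong_induction_on with
  | _ k ih =>
    rcases Nat.eq_zero_or_pos k with rfl | hpos
    · rw [MvPolynomial.esymm_zero]
      exact one_mem _
    have h := MvPolynomial.mul_esymm_eq_sum (Fin N) K k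
    have h2 : (k : MvPolynomial (Fin N) K) * MvPolynomial.esymm (Fin N) K k ∈
        (finPoly K N).range := by
      rw [h]
      refine mul_mem (pow_mem (neg_mem (one_mem _)) _) (sum_mem fun a ha => ?_)
      rw [Finset.mem_filter, Finset.HasAntidiagonal.mem_antidiagonal] at ha
      refine mul_mem (mul_mem (pow_mem (neg_mem (one_mem _)) _) (ih _ ha.2 (by omega))) ?_
      refine ⟨MvPolynomial.X ⟨a.2 - 1, by omega⟩, ?_⟩
      have : a.2 - 1 + 1 = a.2 := by omega
      simp [finPoly, this]
    have h3 := (finPoly K N).range.smul_mem h2 ((k : K)⁻¹)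
    have h4 : ((k : K)⁻¹) • ((k : MvPolynomial (Fin N) K) * MvPolynomial.esymm (Fin N) K k) =
        MvPolynomial.esymm (Fin N) K k := by
      have hk0 : (k : K) ≠ 0 := by exact_mod_cast hpos.ne'
      rw [← map_natCast (algebraMap K (MvPolynomial (Fin N) K)) k, ← Algebra.smul_def, smul_smul,
        inv_mul_cancel₀ hk0, one_smul]
    rwa [h4] at h3

theorem symm_mem_range (N : ℕ) (g : MvPolynomial (Fin N) K) (hg : g.IsSymmetric) :
    g ∈ (finPoly K N).range := by
  obtain ⟨Q, hQ⟩ := MvPolynomial.esymmAlgHom_surjective (σ := Fin N) K (n := N) (by simp) ⟨g, hg⟩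
  have h : g = MvPolynomial.aeval (fun i : Fin N => MvPolynomial.esymm (Fin N) K (i + 1)) Q := by
    rw [← MvPolynomial.esymmAlgHom_apply, hQ]
  rw [h]
  have h2 : MvPolynomial.aeval (fun i : Fin N => MvPolynomial.esymm (Fin N) K (i + 1)) Q ∈
      (MvPolynomial.aeval (R := K)
        (fun i : Fin N => MvPolynomial.esymm (Fin N) K (i + 1))).range := ⟨Q, rfl⟩
  rw [← Algebra.adjoin_range_eq_range_aeval] at h2
  refine Algebra.adjoin_le ?_ h2
  rintro _ ⟨i, rfl⟩
  exact esymm_mem_range K N (i + 1) (by omega)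

theorem finPoly_injective (N : ℕ) : Function.Injective (finPoly K N) := by
  let e := MvPolynomial.esymmAlgEquiv (Fin N) K (n := N) (by simp)
  let ψ := (finPoly K N).codRestrict _ (finPoly_symm K N)
  let φ : MvPolynomial (Fin N) K →ₐ[K] MvPolynomial (Fin N) K := e.symm.toAlgHom.comp ψ
  have hψ : Function.Surjective ψ := by
    rintro ⟨g, hg⟩
    obtain ⟨Q, hQ⟩ := symm_mem_range K N g hg
    exact ⟨Q, Subtype.ext hQ⟩
  have hφ : Function.Surjective φ := e.symm.surjective.comp hψ
  have hinj : Function.Injective φ := injective_of_surjective_end φ.toRingHom hφ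
  intro a b hab
  apply hinj
  have : ψ a = ψ b := Subtype.ext hab
  change e.symm (ψ a) = e.symm (ψ b)
  rw [this]

theorem ofPoly_injective : Function.Injective (ofPoly K) := by
  rw [injective_iff_map_eq_zero]
  intro P hP
  obtain ⟨N, hN⟩ : ∃ N, P.vars ⊆ Finset.range N := Finset.exists_nat_subset_range _
  obtain ⟨Q, rfl⟩ := MvPolynomial.exists_rename_eq_of_vars_subset_range P (Fin.val (n := N))
    Fin.val_injective (fun i hi => ⟨⟨i, Finset.mem_range.1 (hN hi)⟩, rfl⟩)
  have h := restr_ofPoly K N Q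
  rw [hP, ZeroMemClass.coe_zero, map_zero] at h
  have h0 : finPoly K N Q = 0 := by
    apply MvPolynomial.coe_injective
    rw [← h, MvPolynomial.coe_zero]
  rw [(injective_iff_map_eq_zero _).1 (finPoly_injective K N) Q h0, map_zero]

theorem ofPoly_surjective : Function.Surjective (ofPoly K) := by
  classical
  rintro ⟨f, hf⟩
  obtain ⟨N, hN⟩ := hf.2
  let A : Finset (Fin N →₀ ℕ) := (Finsupp.finite_of_degree_le N).toFinset
  let g : MvPolynomial (Fin N) K :=
    ∑ m ∈ A, MvPolynomial.monomial m (MvPowerSeries.coeff m (restr K N f))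
  have hA : ∀ m : Fin N →₀ ℕ, m ∈ A ↔ m.degree ≤ N := by
    intro m
    simp [A]
  have hdeg : ∀ m : Fin N →₀ ℕ, (m.embDomain Fin.valEmbedding).degree = m.degree := by
    intro m
    rw [Finsupp.embDomain_eq_mapDomain, Finsupp.degree_mapDomain]
  have hg : ∀ m, MvPolynomial.coeff m g = MvPowerSeries.coeff m (restr K N f) := by
    intro m
    rw [MvPolynomial.coeff_sum]
    simp_rw [MvPolynomial.coeff_monomial]
    rw [Finset.sum_ite_eq']
    split_ifs with h
    · rfl
    · rw [hA, not_le] at h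
      rw [coeff_restr, hN _ (by rwa [hdeg])]
  have hsymm : g.IsSymmetric := by
    intro e
    ext m
    obtain ⟨m, rfl⟩ : ∃ m', Finsupp.mapDomain e m' = m :=
      ⟨m.mapDomain e.symm, by rw [← Finsupp.mapDomain_comp]; simp⟩
    rw [MvPolynomial.coeff_rename_mapDomain _ e.injective, hg, hg, coeff_restr, coeff_restr]
    let σ : Equiv.Perm ℕ := e.viaFintypeEmbedding Fin.valEmbedding
    have : (m.mapDomain e).embDomain Fin.valEmbedding =
        (m.embDomain Fin.valEmbedding).mapDomain σ := by
      rw [Finsupp.embDomain_eq_mapDomain, Finsupp.embDomain_eq_mapDomain, ← Finsupp.mapDomain_comp,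
        ← Finsupp.mapDomain_comp]
      congr 1
      funext i
      exact (Equiv.Perm.viaFintypeEmbedding_apply_image e Fin.valEmbedding i).symm
    rw [this, ← coeff_perm K f σ, hf.1 σ]
  obtain ⟨P, hP⟩ := symm_mem_range K N g hsymm
  let w : (Fin N →₀ ℕ) → ℕ := fun s => Finsupp.weight (fun i : Fin N => (i : ℕ) + 1) s
  let P₁ : MvPolynomial (Fin N) K :=
    ∑ s ∈ P.support with w s ≤ N, MvPolynomial.monomial s (P.coeff s)
  let P₂ : MvPolynomial (Fin N) K :=
    ∑ s ∈ P.support with ¬ w s ≤ N, MvPolynomial.monomial s (P.coeff s)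
  have hsum : P = P₁ + P₂ := by
    conv_lhs => rw [P.as_sum]
    exact (Finset.sum_filter_add_sum_filter_not _ _ _).symm
  have h1 : finPoly K N P₁ = g := by
    ext m
    have hP' : g = finPoly K N P₁ + finPoly K N P₂ := by rw [← map_add, ← hsum]; exact hP.symm
    rcases le_or_gt m.degree N with h | h
    · rw [hP', MvPolynomial.coeff_add, left_eq_add, map_sum, MvPolynomial.coeff_sum]
      refine Finset.sum_eq_zero fun s hs => ?_
      refine (homog_monomial K s _).coeff_eq_zero ?_
      have := (Finset.mem_filter.1 hs).2
      change m.degree ≠ w s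
      omega
    · rw [hg, coeff_restr, hN _ (by rwa [hdeg]), map_sum, MvPolynomial.coeff_sum]
      refine Finset.sum_eq_zero fun s hs => ?_
      refine (homog_monomial K s _).coeff_eq_zero ?_
      have := (Finset.mem_filter.1 hs).2
      change m.degree ≠ w s
      omega
  refine ⟨MvPolynomial.rename Fin.val P₁, ?_⟩
  rw [← sub_eq_zero]
  apply Subtype.ext
  refine eq_zero_of_restr K (N := N) (Subtype.property _) ?_ ?_
  · intro m hm
    rw [AddSubgroupClass.coe_sub, map_sub, hN m hm, sub_zero, map_sum, map_sum,
      AddSubmonoidClass.coe_finsetSum, map_sum]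
    refine Finset.sum_eq_zero fun s hs => ?_
    exact bounded_monomial K s _ m (lt_of_le_of_lt (Finset.mem_filter.1 hs).2 hm)
  · rw [AddSubgroupClass.coe_sub, map_sub, restr_ofPoly, h1, sub_eq_zero]
    ext m
    rw [MvPolynomial.coeff_coe, hg]

/-- The power sums `p_(1), p_(2), …` are free polynomial generators of `Sym`. -/
def polyEquiv : MvPolynomial ℕ K ≃ₐ[K] SymFun K :=
  AlgEquiv.ofBijective (ofPoly K) ⟨ofPoly_injective K, ofPoly_surjective K⟩


theorem polyEquiv_X (k : ℕ) : polyEquiv K (MvPolynomial.X k) = p K (k + 1) :=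
  MvPolynomial.aeval_X _ _

variable {K}

/-- The algebra map out of `Sym` sending `p_(k)` to `c k` for `1 ≤ k`. -/
def lift {B : Type*} [CommSemiring B] [Algebra K B] (c : ℕ → B) : SymFun K →ₐ[K] B :=
  (MvPolynomial.aeval fun k => c (k + 1)).comp (polyEquiv K).symm.toAlgHom

theorem lift_p {B : Type*} [CommSemiring B] [Algebra K B] (c : ℕ → B) {k : ℕ} (hk : 1 ≤ k) :
    lift c (p K k) = c k := by
  obtain ⟨k, rfl⟩ : ∃ j, k = j + 1 := ⟨k - 1, by omega⟩
  have h : (polyEquiv K).symm (p K (k + 1)) = MvPolynomial.X k := by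
    rw [← polyEquiv_X, AlgEquiv.symm_apply_apply]
  change MvPolynomial.aeval (fun k => c (k + 1)) ((polyEquiv K).symm (p K (k + 1))) = _
  rw [h, MvPolynomial.aeval_X]

/-- An algebra map out of `Sym` is determined by its values on the power sums. -/
theorem hom_ext {B : Type*} [Semiring B] [Algebra K B] {φ ψ : SymFun K →ₐ[K] B}
    (h : ∀ k, 1 ≤ k → φ (p K k) = ψ (p K k)) : φ = ψ := by
  have h1 : φ.comp (polyEquiv K).toAlgHom = ψ.comp (polyEquiv K).toAlgHom := by
    refine MvPolynomial.algHom_ext fun k => ?_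
    change φ (polyEquiv K (MvPolynomial.X k)) = ψ (polyEquiv K (MvPolynomial.X k))
    rw [polyEquiv_X]
    exact h _ (Nat.succ_pos k)
  ext x : 1
  obtain ⟨y, rfl⟩ := (polyEquiv K).surjective x
  exact DFunLike.congr_fun h1 y

/-- The comultiplication of `Sym`, for which the power sums are primitive. -/
def comulHom : SymFun K →ₐ[K] SymFun K ⊗[K] SymFun K :=
  lift fun k => p K k ⊗ₜ[K] (1 : SymFun K) + (1 : SymFun K) ⊗ₜ[K] p K k

/-- The counit of `Sym`. -/
def counitHom : SymFun K →ₐ[K] K := lift fun _ => (0 : K)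

/-- The antipode of `Sym`. -/
def antipodeHom : SymFun K →ₐ[K] SymFun K := lift fun k => -p K k

theorem comulHom_p {k : ℕ} (hk : 1 ≤ k) :
    comulHom (p K k) = p K k ⊗ₜ[K] (1 : SymFun K) + (1 : SymFun K) ⊗ₜ[K] p K k :=
  lift_p _ hk

theorem counitHom_p {k : ℕ} (hk : 1 ≤ k) : counitHom (p K k) = 0 := lift_p _ hk

theorem antipodeHom_p {k : ℕ} (hk : 1 ≤ k) : antipodeHom (p K k) = -p K k := lift_p _ hk

instance instBialgebra : Bialgebra K (SymFun K) :=
  Bialgebra.ofAlgHom comulHom counitHom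
    (by
      apply hom_ext
      intro k hk
      simp [comulHom_p hk, TensorProduct.add_tmul, TensorProduct.tmul_add,
        Algebra.TensorProduct.one_def, add_assoc])
    (by
      apply hom_ext
      intro k hk
      simp [comulHom_p hk, counitHom_p hk])
    (by
      apply hom_ext
      intro k hk
      simp [comulHom_p hk, counitHom_p hk])

theorem comulAlgHom_eq : Bialgebra.comulAlgHom K (SymFun K) = comulHom := rfl

theorem counitAlgHom_eq : Bialgebra.counitAlgHom K (SymFun K) = counitHom := rfl

instance instHopfAlgebra : HopfAlgebra K (SymFun K) :=
  HopfAlgebra.ofAlgHom antipodeHom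
    (by
      apply hom_ext
      intro k hk
      rw [comulAlgHom_eq, counitAlgHom_eq, AlgHom.comp_apply, comulHom_p hk, map_add]
      erw [Algebra.TensorProduct.lift_tmul, Algebra.TensorProduct.lift_tmul]
      rw [antipodeHom_p hk, AlgHom.comp_apply, counitHom_p hk]
      simp)
    (by
      apply hom_ext
      intro k hk
      rw [comulAlgHom_eq, counitAlgHom_eq, AlgHom.comp_apply, comulHom_p hk, map_add]
      erw [Algebra.TensorProduct.lift_tmul, Algebra.TensorProduct.lift_tmul]
      rw [antipodeHom_p hk, AlgHom.comp_apply, counitHom_p hk]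
      simp)

/-- The power sums are primitive. -/
theorem comul_p {k : ℕ} (hk : 1 ≤ k) :
    Coalgebra.comul (R := K) (p K k) = p K k ⊗ₜ[K] (1 : SymFun K) + (1 : SymFun K) ⊗ₜ[K] p K k :=
  comulHom_p hk

theorem antipode_p {k : ℕ} (hk : 1 ≤ k) : HopfAlgebra.antipode K (p K k) = -p K k :=
  antipodeHom_p hk

/-- The Hopf endomorphism of `Sym` sending `p_(k)` to `c k • p_(k)` for `1 ≤ k`. -/
def scale (c : ℕ → K) : SymFun K →ₐc[K] SymFun K :=
  BialgHom.ofAlgHom (lift fun k => c k • p K k)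
    (by
      apply hom_ext
      intro k hk
      rw [counitAlgHom_eq, AlgHom.comp_apply, lift_p _ hk, map_smul, counitHom_p hk, smul_zero])
    (by
      apply hom_ext
      intro k hk
      rw [comulAlgHom_eq, AlgHom.comp_apply, AlgHom.comp_apply, comulHom_p hk, map_add,
        Algebra.TensorProduct.map_tmul, Algebra.TensorProduct.map_tmul, lift_p _ hk, map_one,
        map_smul, comulHom_p hk, smul_add, TensorProduct.smul_tmul', TensorProduct.tmul_smul])

theorem scale_p (c : ℕ → K) {k : ℕ} (hk : 1 ≤ k) : scale c (p K k) = c k • p K k :=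
  lift_p (fun k => c k • p K k) hk

/-- The Eulerian map `E_t`, sending `p_(k)` to `t ^ k • p_(k)`. -/
def eulerian (t : K) : SymFun K →ₐc[K] SymFun K := scale fun k => t ^ k

end Power
end SymFun

/-! ### The rings `𝒯_h` -/

/-- A Hessenberg function `h : [n] → [n]`: extensive and weakly increasing. -/
structure HessenbergFunction (n : ℕ) where
  toFun : Fin n → Fin n
  extensive : ∀ i, i ≤ toFun i
  increasing : ∀ i j, i ≤ j → toFun i ≤ toFun j

/-- The ring `𝒯 = ∏_β ℂ[L]`, the product being over the bijections `β` from the indeterminates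
`R₁, …, R_n` to the indeterminates `L₁, …, L_n`, where `β` is encoded as the permutation of the
indices with `β(R_i) = L_{β i}`. An element is given by its `L`-coordinates `f_β`. -/
abbrev BigRing (n : ℕ) : Type := Equiv.Perm (Fin n) → MvPolynomial (Fin n) ℂ

namespace BigRing

variable {n : ℕ}

/-- The embedding of `ℂ[L]` in `𝒯`, as constant families. -/
def leftPoly (n : ℕ) : MvPolynomial (Fin n) ℂ →ₐ[ℂ] BigRing n :=
  AlgHom.pi fun _ => AlgHom.id ℂ _

/-- The embedding of `ℂ[R]` in `𝒯`: the indeterminate `R_i` acts at the coordinate `β` as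
`β(R_i) = L_{β i}`. -/
def rightPoly (n : ℕ) : MvPolynomial (Fin n) ℂ →ₐ[ℂ] BigRing n :=
  AlgHom.pi fun β => MvPolynomial.rename β

/-- The `R`-coordinate `g_β` of an element of `𝒯`: the polynomial with
`f_β(L) = g_β(β(R₁), …, β(R_n))`. -/
def rightCoord (β : Equiv.Perm (Fin n)) : BigRing n →ₐ[ℂ] MvPolynomial (Fin n) ℂ :=
  (MvPolynomial.rename β.symm).comp (Pi.evalAlgHom ℂ _ β)

/-- The dot action of a permutation `w` of the indeterminates `L`, determined by
`w · (f 𝟏_β) = w(f) 𝟏_{w ∘ β}`. -/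
def dot (w : Equiv.Perm (Fin n)) : BigRing n →ₐ[ℂ] BigRing n :=
  AlgHom.pi fun β => (MvPolynomial.rename w).comp (Pi.evalAlgHom ℂ _ (w⁻¹ * β))

theorem rightCoord_apply (β : Equiv.Perm (Fin n)) (x : BigRing n) :
    rightCoord β x = MvPolynomial.rename β.symm (x β) := rfl

theorem rightCoord_dot (w β : Equiv.Perm (Fin n)) (x : BigRing n) :
    rightCoord β (dot w x) = rightCoord (w⁻¹ * β) x := by
  change MvPolynomial.rename β.symm (MvPolynomial.rename w (x (w⁻¹ * β))) =
    MvPolynomial.rename (w⁻¹ * β).symm (x (w⁻¹ * β))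
  rw [MvPolynomial.rename_rename]
  congr 1

end BigRing

namespace HessenbergFunction

variable {n : ℕ} (h : HessenbergFunction n)

/-- The moment graph `M(h)`: there is a directed edge `β → β'` labelled `(R_i, R_j)` when
`i < j ≤ h(i)`, the pair `(R_i, R_j)` is not an inversion of `β`, and
`β' = β ∘ (R_i ↔ R_j)`. -/
def MomentEdge (β β' : Equiv.Perm (Fin n)) (i j : Fin n) : Prop :=
  i < j ∧ j ≤ h.toFun i ∧ β i < β j ∧ β' = β * Equiv.swap i j

/-- The ring `𝒯_h` of the elements of `𝒯` satisfying all the edge conditions of `M(h)`. -/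
def smallRing : Subalgebra ℂ (BigRing n) where
  carrier := {x | ∀ β β' i j, h.MomentEdge β β' i j →
    (MvPolynomial.X i - MvPolynomial.X j : MvPolynomial (Fin n) ℂ) ∣
      BigRing.rightCoord β x - BigRing.rightCoord β' x}
  mul_mem' := by
    intro x y hx hy β β' i j he
    rw [map_mul, map_mul]
    have := dvd_add (Dvd.dvd.mul_right (hx β β' i j he) (BigRing.rightCoord β y))
      (Dvd.dvd.mul_left (hy β β' i j he) (BigRing.rightCoord β' x))
    convert this using 1
    ring
  add_mem' := by
    intro x y hx hy β β' i j he
    rw [map_add, map_add, add_sub_add_comm]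
    exact dvd_add (hx β β' i j he) (hy β β' i j he)
  algebraMap_mem' := by
    intro r β β' i j he
    rw [AlgHom.commutes, AlgHom.commutes, sub_self]
    exact dvd_zero _

theorem leftPoly_mem (f : MvPolynomial (Fin n) ℂ) : BigRing.leftPoly n f ∈ h.smallRing := by
  induction f using MvPolynomial.induction_on with
  | C a => exact (AlgHom.commutes (BigRing.leftPoly n) a) ▸ h.smallRing.algebraMap_mem a
  | add f g hf hg => rw [map_add]; exact add_mem hf hg
  | mul_X f k hf =>
    rw [map_mul]
    refine mul_mem hf ?_
    rintro β β' i j ⟨_, _, _, rfl⟩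
    rw [BigRing.rightCoord_apply, BigRing.rightCoord_apply]
    change _ ∣ MvPolynomial.rename β.symm (MvPolynomial.X k) -
      MvPolynomial.rename (β * Equiv.swap i j).symm (MvPolynomial.X k)
    rw [MvPolynomial.rename_X, MvPolynomial.rename_X]
    have h1 : (β * Equiv.swap i j).symm k = Equiv.swap i j (β.symm k) := rfl
    rw [h1, Equiv.swap_apply_def]
    split_ifs with h2 h3
    · rw [h2]
    · rw [h3, ← dvd_neg, neg_sub]
    · rw [sub_self]; exact dvd_zero _

theorem rightPoly_mem (g : MvPolynomial (Fin n) ℂ) : BigRing.rightPoly n g ∈ h.smallRing := by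
  have h1 : ∀ β, BigRing.rightCoord β (BigRing.rightPoly n g) = g := by
    intro β
    change MvPolynomial.rename β.symm (MvPolynomial.rename β g) = g
    rw [MvPolynomial.rename_rename]
    simp
  intro β β' i j _
  rw [h1, h1, sub_self]
  exact dvd_zero _

/-- The subring `ℂ[L]` of `𝒯_h`. -/
def leftBase : Subalgebra ℂ h.smallRing :=
  ((BigRing.leftPoly n).codRestrict h.smallRing h.leftPoly_mem).range

/-- The subring `ℂ[R]` of `𝒯_h`. -/
def rightBase : Subalgebra ℂ h.smallRing :=
  ((BigRing.rightPoly n).codRestrict h.smallRing h.rightPoly_mem).range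

theorem dot_mem (w : Equiv.Perm (Fin n)) (x : h.smallRing) :
    BigRing.dot w (x : BigRing n) ∈ h.smallRing := by
  rintro β β' i j ⟨hij, hj, hβ, rfl⟩
  rw [BigRing.rightCoord_dot, BigRing.rightCoord_dot, ← mul_assoc]
  rcases lt_trichotomy ((w⁻¹ * β) i) ((w⁻¹ * β) j) with hlt | heq | hgt
  · exact x.2 _ _ i j ⟨hij, hj, hlt, rfl⟩
  · exact absurd ((w⁻¹ * β).injective heq) hij.ne
  · rw [← dvd_neg, neg_sub]
    refine x.2 _ _ i j ⟨hij, hj, ?_, ?_⟩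
    · simpa using hgt
    · rw [mul_assoc, Equiv.swap_mul_self, mul_one]

/-- The dot action of a permutation `w` of the indeterminates `L` on `𝒯_h`. -/
def dot (w : Equiv.Perm (Fin n)) : h.smallRing →ₐ[ℂ] h.smallRing :=
  ((BigRing.dot w).comp h.smallRing.val).codRestrict h.smallRing (h.dot_mem w)

/-- An element of `𝒯_h` is homogeneous of degree `d` if all its coordinates are. -/
def IsHomogeneous (d : ℕ) (x : h.smallRing) : Prop :=
  ∀ β, ((x : BigRing n) β).IsHomogeneous d

/-- A basis of `𝒯_h` as a module over a subring `A`, consisting of homogeneous elements. -/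
structure HomogeneousBasis (A : Subalgebra ℂ h.smallRing) (ι : Type*) where
  basis : Module.Basis ι A h.smallRing
  deg : ι → ℕ
  homogeneous : ∀ i, h.IsHomogeneous (deg i) (basis i)

/-- The degree-zero part of an element of `𝒯_h` which lies in `ℂ[L]` or in `ℂ[R]`, as a complex
number: the constant term of its polynomial. -/
def scalarPart (x : h.smallRing) : ℂ :=
  MvPolynomial.constantCoeff ((x : BigRing n) 1)

variable {h}

/-- The graded trace `tr_q(w, 𝒯_h, A) = ∑ᵢ q ^ deg(eᵢ) (coefficient of eᵢ in w · eᵢ)`, computed in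
a homogeneous `A`-basis `e`. The dot action preserves degrees, so these coefficients are
complex numbers when `A` is `ℂ[L]` or `ℂ[R]`. -/
def gradedTrace {A : Subalgebra ℂ h.smallRing} {ι : Type*} [Fintype ι]
    (e : h.HomogeneousBasis A ι) (w : Equiv.Perm (Fin n)) : RatFunc ℂ :=
  ∑ i, RatFunc.X ^ e.deg i *
    RatFunc.C (h.scalarPart (e.basis.repr (h.dot w (e.basis i)) i : h.smallRing))

/-- The graded Frobenius characteristic
`frob_q(S(L), 𝒯_h, A) = (1 / n!) ∑_w tr_q(w, 𝒯_h, A) p_(cycle type of w)`. -/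
def frob {A : Subalgebra ℂ h.smallRing} {ι : Type*} [Fintype ι]
    (e : h.HomogeneousBasis A ι) : SymFun (RatFunc ℂ) :=
  ((n.factorial : RatFunc ℂ)⁻¹) • ∑ w : Equiv.Perm (Fin n),
    gradedTrace e w • (w.partition.parts.map (SymFun.p (RatFunc ℂ))).prod

end HessenbergFunction

/-- The linear endomorphism `id * (S ∘ E_q)` of `Sym`, where `*` is the convolution product
`φ * ψ = ∇ ∘ (φ ⊗ ψ) ∘ Δ` and `S` is the antipode. -/
def idConvAntipodeEulerian : SymFun (RatFunc ℂ) →ₗ[RatFunc ℂ] SymFun (RatFunc ℂ) :=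
  (WithConv.toConv (LinearMap.id : SymFun (RatFunc ℂ) →ₗ[RatFunc ℂ] SymFun (RatFunc ℂ)) *
    WithConv.toConv (HopfAlgebra.antipode (RatFunc ℂ) ∘ₗ
      (SymFun.eulerian (RatFunc.X : RatFunc ℂ)).toLinearMap)).ofConv

end

/-!
Write an element of `𝒯_h` in its `R`-coordinates `g_β`. The condition along the edge between `β`
and `β ∘ (R_i ↔ R_j)` is then divisibility by `X i - X j`, and the argument has two parts.

*Freeness.* The permutations are ordered by the positions of their values, from the largest value
down (`Precedes`), so that all the edges ending in `β` come from vertices before `β`. An element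
which vanishes before `β` is divisible at `β` by the product of the labels of these edges. The
point is that some homogeneous element attains this product (`exists_flowUp`). Such flow-up
classes form a triangular system, and triangularity alone makes them a basis over any subring
whose coordinate maps are isomorphisms onto the polynomial ring (`nonempty_homogeneousBasis`);
this covers `ℂ[L]` and `ℂ[R]` at once.

Flow-up classes are built one value at a time. Let `v` be the largest value which may still move.
A class on the vertices with `v` at position `p` is multiplied by
`∏ (X p - X j)` over the movable positions `p < j ≤ h(p)`, extended by zero to the vertices with
`v` further to the right, and then extended to the vertices with `v` at position `i`, for
`i = p - 1, p - 2, …` (`exists_extension`). There, the edges from position `i` to positions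
`j` with `i < j ≤ h(i)` prescribe the new polynomial at `X i = X j`, so it is found by Newton
interpolation in the variable `X i` (`exists_newton_step`). The divided differences which occur
are again compatible families of polynomials. This rests on the fact that the positions
`i < j ≤ h(i)` form a clique, and on the second order congruence `sq_dvd_identify`.

*Change of base ring.* For `w ∈ S(L)` consider the graded trace of `w` on the complex vector space
`𝒯_h`. The products of the monomials of `A` with an `A`-basis form a `ℂ`-basis, and the trace does
not depend on the basis (`trace_eq_trace`), so it equals `tr_q(w, 𝒯_h, A)` times the graded trace
of `w` on `A` (`coeff_gradedTracePoly_mul`). The latter counts the monomials fixed by `w`: it is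
`∏ 1 / (1 - q ^ k)` over the cycle lengths `k` of `w` for `A = ℂ[L]`
(`prod_mul_fixedMonomialSeries`), and `1 / (1 - q) ^ n` for `A = ℂ[R]`, on which `w` acts trivially.
Hence `(1 - q) ^ n tr_q(w, 𝒯_h, ℂ[L]) = ∏ (1 - q ^ k) tr_q(w, 𝒯_h, ℂ[R])`, which is the asserted
identity, since `id * (S ∘ E_q)` is the algebra map with `p_k ↦ (1 - q ^ k) p_k`.
-/

/-! ### Linear forms `X i - X j` -/

namespace MvPolynomial

variable {σ R : Type*} [DecidableEq σ] [CommRing R]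

/-- The substitution `X i ↦ X j`, whose kernel is generated by `X i - X j`. -/
noncomputable def identify (i j : σ) : MvPolynomial σ R →ₐ[R] MvPolynomial σ R :=
  rename (Function.update id i j)

@[simp]
theorem identify_X_left (i j : σ) : identify i j (X i : MvPolynomial σ R) = X j := by
  simp [identify]

theorem identify_X_of_ne {i k : σ} (j : σ) (hk : k ≠ i) :
    identify i j (X k : MvPolynomial σ R) = X k := by
  simp [identify, hk]

theorem X_sub_X_dvd_sub_identify (i j : σ) (f : MvPolynomial σ R) :
    X i - X j ∣ f - identify i j f := by
  induction f using MvPolynomial.induction_on with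
  | C a => simp [identify]
  | add f g hf hg =>
    rw [map_add, add_sub_add_comm]
    exact dvd_add hf hg
  | mul_X f k hf =>
    have h1 : f * X k - identify i j (f * X k) =
        (f - identify i j f) * X k + identify i j f * (X k - identify i j (X k)) := by
      rw [map_mul]; ring
    rw [h1]
    refine dvd_add (hf.mul_right _) (Dvd.dvd.mul_left ?_ _)
    by_cases hk : k = i
    · rw [hk, identify_X_left]
    · rw [identify_X_of_ne j hk, sub_self]; exact dvd_zero _

theorem X_sub_X_dvd_iff {i j : σ} {f : MvPolynomial σ R} :
    X i - X j ∣ f ↔ identify i j f = 0 := by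
  constructor
  · rintro ⟨g, rfl⟩
    by_cases h : j = i
    · simp [h]
    · rw [map_mul, map_sub, identify_X_left, identify_X_of_ne j h, sub_self, zero_mul]
  · intro h
    have := X_sub_X_dvd_sub_identify i j f
    rwa [h, sub_zero] at this

theorem prime_X_sub_X [IsDomain R] {i j : σ} (hij : i ≠ j) :
    Prime (X i - X j : MvPolynomial σ R) := by
  refine ⟨sub_ne_zero.2 fun h => hij (X_injective h), fun h => ?_, fun f g h => ?_⟩
  · have := X_sub_X_dvd_iff.1 (h.dvd (a := 1))
    simp at this
  · simpa [X_sub_X_dvd_iff] using h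

/-- Two of the linear forms are proportional only if they involve the same indeterminates. -/
theorem eq_or_eq_of_X_sub_X_dvd [Nontrivial R] {i j k l : σ} (hkl : k ≠ l)
    (h : (X i - X j : MvPolynomial σ R) ∣ X k - X l) : k = i ∧ l = j ∨ k = j ∧ l = i := by
  rw [X_sub_X_dvd_iff, map_sub, sub_eq_zero] at h
  by_cases h1 : k = i
  · have h2 : l ≠ i := fun h => hkl (h1.trans h.symm)
    rw [h1, identify_X_left, identify_X_of_ne j h2] at h
    exact Or.inl ⟨h1, (X_injective h).symm⟩
  · rw [identify_X_of_ne j h1] at h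
    by_cases h2 : l = i
    · rw [h2, identify_X_left] at h
      exact Or.inr ⟨X_injective h, h2⟩
    · rw [identify_X_of_ne j h2] at h
      exact absurd (X_injective h) hkl

end MvPolynomial

/-! ### Extension of compatible families -/

namespace HessenbergFunction

open MvPolynomial

variable {n : ℕ} (h : HessenbergFunction n)

/-- A family of polynomials satisfies the edge conditions of `M(h)` along all the edges with both
ends in `U`. The families are in `R`-coordinates, so the edge `β — β * swap i j` has label
`X i - X j`. -/
def Compatible (U : Set (Equiv.Perm (Fin n))) (g : Equiv.Perm (Fin n) → MvPolynomial (Fin n) ℂ) :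
    Prop :=
  ∀ β ∈ U, ∀ i j, i < j → j ≤ h.toFun i → β * Equiv.swap i j ∈ U →
    X i - X j ∣ g β - g (β * Equiv.swap i j)

/-- A set of permutations is a block with free positions `A` if right multiplication by a
transposition stays in the set exactly when both of its points are free. -/
def IsBlock (F : Set (Equiv.Perm (Fin n))) (A : Set (Fin n)) : Prop :=
  ∀ γ ∈ F, ∀ a b, a ≠ b → (γ * Equiv.swap a b ∈ F ↔ a ∈ A ∧ b ∈ A)

variable {h}

theorem Compatible.dvd {U : Set (Equiv.Perm (Fin n))}
    {g : Equiv.Perm (Fin n) → MvPolynomial (Fin n) ℂ} (hg : h.Compatible U g)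
    {β β' : Equiv.Perm (Fin n)} (hβ : β ∈ U) (hβ' : β' ∈ U) {i j : Fin n}
    (hij : i < j) (hj : j ≤ h.toFun i) (he : β' = β * Equiv.swap i j) :
    X i - X j ∣ g β - g β' := by
  subst he
  exact hg β hβ i j hij hj hβ'

/-- If polynomials at six vertices forming a complete bipartite graph satisfy the edge conditions,
then a second order congruence holds after the substitution `X i ↦ X t`. -/
theorem sq_dvd_identify {i j t : Fin n} (hij : i ≠ j) (hit : i ≠ t) (hjt : j ≠ t)
    {x x' a a' b b' : MvPolynomial (Fin n) ℂ}
    (hx : X j - X t ∣ x - x') (hb : X i - X j ∣ b - b') (ha : X i - X t ∣ a - a')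
    (hxa : X i - X j ∣ x - a) (hxa' : X i - X j ∣ x' - a')
    (hab : X j - X t ∣ a - b') (hab' : X j - X t ∣ a' - b) :
    (X t - X j) ^ 2 ∣ identify i t ((b - x) - (b' - x')) := by
  obtain ⟨e, he⟩ := hx
  obtain ⟨u, hu⟩ := hb
  obtain ⟨v, hv⟩ := ha
  obtain ⟨f, hf⟩ := hxa
  obtain ⟨f', hf'⟩ := hxa'
  obtain ⟨c, hc⟩ := hab
  obtain ⟨c', hc'⟩ := hab'
  have h1 : (X i - X j : MvPolynomial (Fin n) ℂ) ∣ v - e := by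
    have h2 : (X i - X j : MvPolynomial (Fin n) ℂ) ∣ (X i - X t) * (v - e) :=
      ⟨f' - f - e, by linear_combination -hv + hf' - hf + he⟩
    refine ((prime_X_sub_X hij).dvd_or_dvd h2).resolve_left fun h3 => ?_
    rcases eq_or_eq_of_X_sub_X_dvd hit h3 with h4 | h4
    · exact hjt h4.2.symm
    · exact hij h4.1
  have h2 : (X j - X t : MvPolynomial (Fin n) ℂ) ∣ v + u := by
    have h2 : (X j - X t : MvPolynomial (Fin n) ℂ) ∣ (X i - X t) * (v + u) :=
      ⟨c - c' + u, by linear_combination -hv - hu + hc - hc'⟩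
    refine ((prime_X_sub_X hjt).dvd_or_dvd h2).resolve_left fun h3 => ?_
    rcases eq_or_eq_of_X_sub_X_dvd hit h3 with h4 | h4
    · exact hij h4.1
    · exact hit h4.1
  obtain ⟨p, hp⟩ := h1
  obtain ⟨q, hq⟩ := h2
  have h3 : (b - x) - (b' - x') = (X i - X j) * u - (X j - X t) * e := by
    rw [← hu, ← he]; ring
  have h4 : u + e = (X j - X t) * q - (X i - X j) * p := by rw [← hp, ← hq]; ring
  have h5 := congrArg (identify i t) h4
  rw [h3]
  simp only [map_add, map_sub, map_mul, identify_X_left, identify_X_of_ne t hij.symm,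
    identify_X_of_ne t hit.symm] at h5 ⊢
  exact ⟨-identify i t q - identify i t p, by linear_combination (X t - X j) * h5⟩

/-- If a transposition of positions moves the value `v` to the right, it moves it from its smaller
point to its larger point. -/
theorem swap_eq_of_lt {γ : Equiv.Perm (Fin n)} {v a b i : Fin n} (hγ : γ.symm v = i) (hab : a < b)
    (hlt : i < (γ * Equiv.swap a b).symm v) : a = i ∧ (γ * Equiv.swap a b).symm v = b := by
  have h1 : (γ * Equiv.swap a b).symm v = Equiv.swap a b i := by rw [← hγ]; rfl
  rw [h1, Equiv.swap_apply_def] at hlt ⊢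
  split_ifs at hlt ⊢ with h2 h3
  · exact ⟨h2.symm, rfl⟩
  · subst h3
    exact absurd hab hlt.asymm
  · exact absurd hlt (lt_irrefl _)

theorem mul_swap_symm (γ : Equiv.Perm (Fin n)) (a b v : Fin n) :
    (γ * Equiv.swap a b).symm v = Equiv.swap a b (γ.symm v) := rfl

theorem mul_mul_cancel_swap (γ : Equiv.Perm (Fin n)) (a b : Fin n) :
    γ * Equiv.swap a b * Equiv.swap a b = γ := by
  rw [mul_assoc, Equiv.swap_mul_self, mul_one]

theorem swap_mul_swap_comm_of_disjoint {a b c d : Fin n} (h1 : a ≠ c) (h2 : a ≠ d) (h3 : b ≠ c)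
    (h4 : b ≠ d) : Equiv.swap a b * Equiv.swap c d = Equiv.swap c d * Equiv.swap a b := by
  rw [Equiv.mul_swap_eq_swap_mul, Equiv.swap_apply_of_ne_of_ne h1.symm h3.symm,
    Equiv.swap_apply_of_ne_of_ne h2.symm h4.symm]

theorem swap_mul_swap_of_left {a b c : Fin n} (h1 : c ≠ a) (h2 : c ≠ b) :
    Equiv.swap a b * Equiv.swap a c = Equiv.swap b c * Equiv.swap a b := by
  rw [Equiv.mul_swap_eq_swap_mul, Equiv.swap_apply_left, Equiv.swap_apply_of_ne_of_ne h1 h2]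

theorem swap_mul_swap_of_middle {a b c : Fin n} (h1 : a ≠ b) (h2 : a ≠ c) :
    Equiv.swap a b * Equiv.swap b c = Equiv.swap b c * Equiv.swap a c := by
  rw [Equiv.mul_swap_eq_swap_mul (Equiv.swap b c), Equiv.swap_apply_right,
    Equiv.swap_apply_of_ne_of_ne h1 h2]

theorem swap_mul_swap_mul_swap_of_middle {a b c : Fin n} (h1 : a ≠ b) (h2 : a ≠ c) :
    Equiv.swap b c * (Equiv.swap a b * Equiv.swap b c) = Equiv.swap a c := by
  rw [swap_mul_swap_of_middle h1 h2, ← mul_assoc, Equiv.swap_mul_self, one_mul]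

variable (h) in
/-- Adjacency of positions in the graph with the edges `i — j` for `i < j ≤ h(i)`. -/
def Adj (a b : Fin n) : Prop := a < b ∧ b ≤ h.toFun a ∨ b < a ∧ a ≤ h.toFun b

theorem Adj.ne {a b : Fin n} (hab : h.Adj a b) : a ≠ b := by
  rcases hab with h1 | h1
  · exact h1.1.ne
  · exact h1.1.ne'

theorem Compatible.dvd_of_adj {U : Set (Equiv.Perm (Fin n))}
    {g : Equiv.Perm (Fin n) → MvPolynomial (Fin n) ℂ} (hg : h.Compatible U g)
    {β β' : Equiv.Perm (Fin n)} {a b : Fin n} (hab : h.Adj a b) (hβ : β ∈ U) (hβ' : β' ∈ U)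
    (he : β * Equiv.swap a b = β') : X a - X b ∣ g β - g β' := by
  rcases hab with h1 | h1
  · exact hg.dvd hβ hβ' h1.1 h1.2 he.symm
  · rw [← neg_sub (X b), neg_dvd]
    exact hg.dvd hβ hβ' h1.1 h1.2 (by rw [← he, Equiv.swap_comm])

theorem dvd_identify_of_dvd {i t a b : Fin n} (ha : a ≠ i) (hb : b ≠ i)
    {f : MvPolynomial (Fin n) ℂ} (hf : X a - X b ∣ f) : X a - X b ∣ identify i t f := by
  have := map_dvd (identify i t) hf
  rwa [map_sub, identify_X_of_ne t ha, identify_X_of_ne t hb] at this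

theorem dvd_identify_of_dvd_left {i t b : Fin n} (hb : b ≠ i)
    {f : MvPolynomial (Fin n) ℂ} (hf : X i - X b ∣ f) : X t - X b ∣ identify i t f := by
  have := map_dvd (identify i t) hf
  rwa [map_sub, identify_X_left, identify_X_of_ne t hb] at this

section Defect

variable {F : Set (Equiv.Perm (Fin n))} {A : Set (Fin n)} {v i t : Fin n}
  {g : Equiv.Perm (Fin n) → MvPolynomial (Fin n) ℂ}

/-! The *defect* at a vertex `γ` with `v` in position `i` is the failure of the edge condition
between `γ` and `γ * swap i t`, taken modulo `X i - X t`, that is, after the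
substitution `X i ↦ X t`. -/

/-- The defect is divisible by `X t - X j` when the edge condition towards position `j` holds:
the vertices with `v` in positions `t` and `j` are linked by two further edges. -/
theorem defect_dvd (hF : IsBlock F A) (hit : i < t) (ht : t ≤ h.toFun i) (htA : t ∈ A)
    (hiA : i ∈ A) (hU : h.Compatible {γ | γ ∈ F ∧ i < γ.symm v} g)
    {γ : Equiv.Perm (Fin n)} (hγ : γ ∈ F) (hγi : γ.symm v = i) {j : Fin n} (hjA : j ∈ A)
    (hij : i < j) (hjt : j < t) (hj : X i - X j ∣ g γ - g (γ * Equiv.swap i j)) :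
    X t - X j ∣ identify i t (g (γ * Equiv.swap i t) - g γ) := by
  have m1 : γ * Equiv.swap i t ∈ F := (hF γ hγ i t hit.ne).2 ⟨hiA, htA⟩
  have m2 : γ * Equiv.swap i t * Equiv.swap t j ∈ F := (hF _ m1 t j hjt.ne').2 ⟨htA, hjA⟩
  have m3 : γ * Equiv.swap i j ∈ F := (hF γ hγ i j hij.ne).2 ⟨hiA, hjA⟩
  have p1 : (γ * Equiv.swap i t).symm v = t := by rw [mul_swap_symm, hγi, Equiv.swap_apply_left]
  have p2 : (γ * Equiv.swap i t * Equiv.swap t j).symm v = j := by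
    rw [mul_swap_symm, p1, Equiv.swap_apply_left]
  have p3 : (γ * Equiv.swap i j).symm v = j := by rw [mul_swap_symm, hγi, Equiv.swap_apply_left]
  have e1 := hU.dvd_of_adj (β := γ * Equiv.swap i t) (β' := γ * Equiv.swap i t * Equiv.swap t j)
    (a := t) (b := j) (Or.inr ⟨hjt, ht.trans (h.increasing i j hij.le)⟩)
    ⟨m1, by rw [p1]; exact hit⟩ ⟨m2, by rw [p2]; exact hij⟩ rfl
  have e2 := hU.dvd_of_adj (β := γ * Equiv.swap i t * Equiv.swap t j) (β' := γ * Equiv.swap i j)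
    (a := i) (b := t) (Or.inl ⟨hit, ht⟩)
    ⟨m2, by rw [p2]; exact hij⟩ ⟨m3, by rw [p3]; exact hij⟩ (by
      rw [mul_assoc, mul_assoc]
      congr 1
      rw [Equiv.swap_comm i t, Equiv.swap_comm t j, Equiv.swap_comm i j,
        swap_mul_swap_mul_swap_of_middle hjt.ne hij.ne'])
  have e3 : g (γ * Equiv.swap i t) - g γ =
      (g (γ * Equiv.swap i t) - g (γ * Equiv.swap i t * Equiv.swap t j)) +
      (g (γ * Equiv.swap i t * Equiv.swap t j) - g (γ * Equiv.swap i j)) -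
      (g γ - g (γ * Equiv.swap i j)) := by ring
  rw [e3, map_sub, map_add, X_sub_X_dvd_iff.1 e2, add_zero]
  exact dvd_sub (dvd_identify_of_dvd hit.ne' hij.ne' e1) (dvd_identify_of_dvd_left hij.ne' hj)

/-- The defects form a compatible family on the vertices with `v` in position `i`. -/
theorem defect_compatible (hF : IsBlock F A) (hit : i < t) (ht : t ≤ h.toFun i) (htA : t ∈ A)
    (hiA : i ∈ A) (hU : h.Compatible {γ | γ ∈ F ∧ i < γ.symm v} g)
    (hi : h.Compatible {γ | γ ∈ F ∧ γ.symm v = i} g) :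
    h.Compatible {γ | γ ∈ F ∧ γ.symm v = i}
      fun γ => identify i t (g (γ * Equiv.swap i t) - g γ) := by
  -- Only the edges `t — c` need an argument. For `c < i` there is an edge `i — c`. For `i < c`,
  -- where `i — c` need not be an edge, the three edges through the vertices with `v` in
  -- position `c` are used instead.
  have key : ∀ γ ∈ F, γ.symm v = i → ∀ c, c ≠ i → h.Adj t c → c ∈ A →
      X t - X c ∣ identify i t (g (γ * Equiv.swap i t) - g γ) -
        identify i t (g (γ * Equiv.swap t c * Equiv.swap i t) - g (γ * Equiv.swap t c)) := by
    intro γ hγ hγi c hci htc hcA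
    have hct := htc.ne
    have m0 : γ * Equiv.swap t c ∈ F := (hF γ hγ t c hct).2 ⟨htA, hcA⟩
    have p0 : (γ * Equiv.swap t c).symm v = i := by
      rw [mul_swap_symm, hγi, Equiv.swap_apply_of_ne_of_ne hit.ne hci.symm]
    have m1 : γ * Equiv.swap i t ∈ F := (hF γ hγ i t hit.ne).2 ⟨hiA, htA⟩
    have p1 : (γ * Equiv.swap i t).symm v = t := by rw [mul_swap_symm, hγi, Equiv.swap_apply_left]
    have m4 : γ * Equiv.swap t c * Equiv.swap i t ∈ F := (hF _ m0 i t hit.ne).2 ⟨hiA, htA⟩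
    have p4 : (γ * Equiv.swap t c * Equiv.swap i t).symm v = t := by
      rw [mul_swap_symm, p0, Equiv.swap_apply_left]
    have e0 := hi.dvd_of_adj htc ⟨hγ, hγi⟩ ⟨m0, p0⟩ rfl
    rw [← map_sub, sub_sub_sub_comm, map_sub]
    refine dvd_sub ?_ (dvd_identify_of_dvd hit.ne' hci e0)
    rcases lt_or_gt_of_ne hci with hlt | hgt
    · have hic : h.Adj i c := by
        rcases htc with h1 | h1
        · exact absurd (hit.trans h1.1) hlt.asymm
        · exact Or.inr ⟨hlt, hit.le.trans h1.2⟩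
      refine dvd_identify_of_dvd_left hci (hU.dvd_of_adj hic ⟨m1, by rw [p1]; exact hit⟩
        ⟨m4, by rw [p4]; exact hit⟩ ?_)
      rw [mul_assoc, mul_assoc]
      congr 1
      exact swap_mul_swap_of_left hci hct.symm
    · have m2 : γ * Equiv.swap i t * Equiv.swap t c ∈ F := (hF _ m1 t c hct).2 ⟨htA, hcA⟩
      have p2 : (γ * Equiv.swap i t * Equiv.swap t c).symm v = c := by
        rw [mul_swap_symm, p1, Equiv.swap_apply_left]
      have m3 : γ * Equiv.swap i t * Equiv.swap t c * Equiv.swap i t ∈ F :=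
        (hF _ m2 i t hit.ne).2 ⟨hiA, htA⟩
      have p3 : (γ * Equiv.swap i t * Equiv.swap t c * Equiv.swap i t).symm v = c := by
        rw [mul_swap_symm, p2, Equiv.swap_apply_of_ne_of_ne hgt.ne' hct.symm]
      have e1 := hU.dvd_of_adj htc ⟨m1, by rw [p1]; exact hit⟩ ⟨m2, by rw [p2]; exact hgt⟩ rfl
      have e2 := hU.dvd_of_adj (a := i) (b := t) (Or.inl ⟨hit, ht⟩) ⟨m2, by rw [p2]; exact hgt⟩
        ⟨m3, by rw [p3]; exact hgt⟩ rfl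
      have e3 := hU.dvd_of_adj htc ⟨m3, by rw [p3]; exact hgt⟩ ⟨m4, by rw [p4]; exact hit⟩ (by
        rw [mul_assoc, mul_assoc, mul_assoc, mul_assoc]
        congr 1
        rw [swap_mul_swap_mul_swap_of_middle hit.ne hci.symm]
        exact swap_mul_swap_of_left hci hct.symm)
      have e4 := dvd_add (dvd_identify_of_dvd (t := t) hit.ne' hci e1)
        (dvd_identify_of_dvd (t := t) hit.ne' hci e3)
      have e5 := X_sub_X_dvd_iff.1 e2
      rw [map_sub] at e5 e4 ⊢
      rw [map_sub] at e4
      convert e4 using 1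
      linear_combination e5
  rintro γ ⟨hγ, hγi⟩ a b hab hb ⟨hγ', hγi'⟩
  obtain ⟨haA, hbA⟩ := (hF γ hγ a b hab.ne).1 hγ'
  have hne : i ≠ a ∧ i ≠ b := by
    rw [mul_swap_symm, hγi] at hγi'
    rw [← not_or]
    rintro (rfl | rfl)
    · rw [Equiv.swap_apply_left] at hγi'; exact hab.ne' hγi'
    · rw [Equiv.swap_apply_right] at hγi'; exact hab.ne hγi'
  by_cases hta : a = t
  · subst hta
    exact key γ hγ hγi b hne.2.symm (Or.inl ⟨hab, hb⟩) hbA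
  by_cases htb : b = t
  · subst htb
    have := key γ hγ hγi a hne.1.symm (Or.inr ⟨hab, hb⟩) haA
    rw [Equiv.swap_comm a b, ← neg_sub (X b), neg_dvd]
    exact this
  have m1 : γ * Equiv.swap i t ∈ F := (hF γ hγ i t hit.ne).2 ⟨hiA, htA⟩
  have p1 : (γ * Equiv.swap i t).symm v = t := by rw [mul_swap_symm, hγi, Equiv.swap_apply_left]
  have m4 : γ * Equiv.swap a b * Equiv.swap i t ∈ F := (hF _ hγ' i t hit.ne).2 ⟨hiA, htA⟩
  have p4 : (γ * Equiv.swap a b * Equiv.swap i t).symm v = t := by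
    rw [mul_swap_symm, hγi', Equiv.swap_apply_left]
  have e0 := hi γ ⟨hγ, hγi⟩ a b hab hb ⟨hγ', hγi'⟩
  have e1 := hU.dvd (β := γ * Equiv.swap i t) (β' := γ * Equiv.swap a b * Equiv.swap i t)
    ⟨m1, by rw [p1]; exact hit⟩ ⟨m4, by rw [p4]; exact hit⟩ hab hb (by
      rw [mul_assoc, mul_assoc, swap_mul_swap_comm_of_disjoint hne.1.symm hta hne.2.symm htb])
  change _ ∣ identify i t _ - identify i t _
  rw [← map_sub, sub_sub_sub_comm]
  exact dvd_identify_of_dvd hne.1.symm hne.2.symm (dvd_sub e1 e0)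

/-- Along the edges `j — t` the difference of the defects is even divisible by the square of
the label. -/
theorem defect_sq_dvd (hF : IsBlock F A) (hit : i < t) (ht : t ≤ h.toFun i) (htA : t ∈ A)
    (hiA : i ∈ A) (hU : h.Compatible {γ | γ ∈ F ∧ i < γ.symm v} g)
    (hi : h.Compatible {γ | γ ∈ F ∧ γ.symm v = i} g) {j : Fin n} (hjA : j ∈ A)
    (hij : i < j) (hjt : j < t)
    (hj : ∀ γ ∈ F, γ.symm v = i → X i - X j ∣ g γ - g (γ * Equiv.swap i j))
    {γ : Equiv.Perm (Fin n)} (hγ : γ ∈ F) (hγi : γ.symm v = i) :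
    (X t - X j) ^ 2 ∣ identify i t (g (γ * Equiv.swap i t) - g γ) -
      identify i t (g (γ * Equiv.swap j t * Equiv.swap i t) - g (γ * Equiv.swap j t)) := by
  have hadj : h.Adj j t := Or.inl ⟨hjt, ht.trans (h.increasing i j hij.le)⟩
  have m' : γ * Equiv.swap j t ∈ F := (hF γ hγ j t hjt.ne).2 ⟨hjA, htA⟩
  have p' : (γ * Equiv.swap j t).symm v = i := by
    rw [mul_swap_symm, hγi, Equiv.swap_apply_of_ne_of_ne hij.ne hit.ne]
  have ma : γ * Equiv.swap i j ∈ F := (hF γ hγ i j hij.ne).2 ⟨hiA, hjA⟩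
  have pa : (γ * Equiv.swap i j).symm v = j := by rw [mul_swap_symm, hγi, Equiv.swap_apply_left]
  have ma' : γ * Equiv.swap j t * Equiv.swap i j ∈ F := (hF _ m' i j hij.ne).2 ⟨hiA, hjA⟩
  have pa' : (γ * Equiv.swap j t * Equiv.swap i j).symm v = j := by
    rw [mul_swap_symm, p', Equiv.swap_apply_left]
  have mb : γ * Equiv.swap i t ∈ F := (hF γ hγ i t hit.ne).2 ⟨hiA, htA⟩
  have pb : (γ * Equiv.swap i t).symm v = t := by rw [mul_swap_symm, hγi, Equiv.swap_apply_left]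
  have mb' : γ * Equiv.swap j t * Equiv.swap i t ∈ F := (hF _ m' i t hit.ne).2 ⟨hiA, htA⟩
  have pb' : (γ * Equiv.swap j t * Equiv.swap i t).symm v = t := by
    rw [mul_swap_symm, p', Equiv.swap_apply_left]
  rw [← map_sub]
  refine sq_dvd_identify (a := g (γ * Equiv.swap i j))
    (a' := g (γ * Equiv.swap j t * Equiv.swap i j)) hij.ne hit.ne hjt.ne
    (hi.dvd_of_adj hadj ⟨hγ, hγi⟩ ⟨m', p'⟩ rfl)
    (hU.dvd_of_adj (Or.inl ⟨hij, hjt.le.trans ht⟩) ⟨mb, by rw [pb]; exact hit⟩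
      ⟨mb', by rw [pb']; exact hit⟩ ?_)
    (hU.dvd_of_adj (Or.inl ⟨hit, ht⟩) ⟨ma, by rw [pa]; exact hij⟩
      ⟨ma', by rw [pa']; exact hij⟩ ?_)
    (hj γ hγ hγi) (hj _ m' p')
    (hU.dvd_of_adj hadj ⟨ma, by rw [pa]; exact hij⟩ ⟨mb', by rw [pb']; exact hit⟩ ?_)
    (hU.dvd_of_adj hadj ⟨ma', by rw [pa']; exact hij⟩ ⟨mb, by rw [pb]; exact hit⟩ ?_)
  · rw [mul_assoc, mul_assoc, swap_mul_swap_of_left hij.ne' hjt.ne, Equiv.swap_comm t j]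
  · rw [mul_assoc, mul_assoc, swap_mul_swap_of_left hit.ne' hjt.ne']
  · rw [mul_assoc, mul_assoc, swap_mul_swap_of_middle hij.ne hit.ne]
  · rw [mul_assoc, mul_assoc, swap_mul_swap_mul_swap_of_middle hij.ne hit.ne]

end Defect

/-- Distinct linear forms are coprime, so a common multiple is divisible by their product. -/
theorem prod_X_sub_X_dvd {ι : Type*} {S : Finset ι} {e : ι → Fin n × Fin n}
    (hlt : ∀ k ∈ S, (e k).1 < (e k).2) (he : Set.InjOn e S) {f : MvPolynomial (Fin n) ℂ}
    (hf : ∀ k ∈ S, X (e k).1 - X (e k).2 ∣ f) : ∏ k ∈ S, (X (e k).1 - X (e k).2) ∣ f := by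
  refine Finset.prod_dvd_of_isRelPrime (fun k hk l hl hkl => ?_) hf
  change IsRelPrime _ _
  rw [(prime_X_sub_X (hlt k hk).ne).irreducible.isRelPrime_iff_not_dvd]
  intro hd
  have h1 := hlt k hk
  have h2 := hlt l hl
  rcases eq_or_eq_of_X_sub_X_dvd h2.ne hd with h3 | h3
  · exact hkl (he hk hl (Prod.ext h3.1.symm h3.2.symm))
  · rw [h3.1, h3.2] at h2
    exact h1.asymm h2

section Extension

variable {F : Set (Equiv.Perm (Fin n))} {A : Set (Fin n)} {v i : Fin n}
  {g : Equiv.Perm (Fin n) → MvPolynomial (Fin n) ℂ}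

/-- The Newton interpolation step: the edge conditions between the vertices with `v` in position
`i` and those with `v` in position `j`, known for `j < t`, are achieved for `j = t` by adding a
multiple of `∏ (X i - X j)`, the product being over these `j`. -/
theorem exists_newton_step (hF : IsBlock F A) (hv : ∀ γ ∈ F, γ.symm v ∈ A) {t : Fin n}
    (hit : i < t) (ht : t ≤ h.toFun i) (htA : t ∈ A)
    (hU : h.Compatible {γ | γ ∈ F ∧ i < γ.symm v} g)
    (hi : h.Compatible {γ | γ ∈ F ∧ γ.symm v = i} g)
    (hlt : ∀ γ ∈ F, γ.symm v = i → ∀ j ∈ A, i < j → j < t →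
      X i - X j ∣ g γ - g (γ * Equiv.swap i j)) :
    ∃ g' : Equiv.Perm (Fin n) → MvPolynomial (Fin n) ℂ,
      (∀ γ, ¬ (γ ∈ F ∧ γ.symm v = i) → g' γ = g γ) ∧
      h.Compatible {γ | γ ∈ F ∧ γ.symm v = i} g' ∧
      ∀ γ ∈ F, γ.symm v = i → ∀ j ∈ A, i < j → j ≤ t →
        X i - X j ∣ g' γ - g' (γ * Equiv.swap i j) := by
  classical
  let S : Finset (Fin n) := {j | j ∈ A ∧ i < j ∧ j < t}
  have hS : ∀ j, j ∈ S ↔ j ∈ A ∧ i < j ∧ j < t := fun j => by simp [S]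
  let y := fun γ => identify i t (g (γ * Equiv.swap i t) - g γ)
  let Q : MvPolynomial (Fin n) ℂ := ∏ j ∈ S, (X t - X j)
  let P : MvPolynomial (Fin n) ℂ := ∏ j ∈ S, (X i - X j)
  have hQ : ∀ γ, γ ∈ F ∧ γ.symm v = i → Q ∣ y γ := by
    rintro γ ⟨hγ, hγi⟩
    have h1 : Q = (-1) ^ S.card * ∏ j ∈ S, (X j - X t) := by
      rw [← Finset.prod_const, ← Finset.prod_mul_distrib]
      exact Finset.prod_congr rfl fun j _ => by ring
    rw [h1, (isUnit_one.neg.pow _).mul_left_dvd]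
    refine prod_X_sub_X_dvd (e := fun j => (j, t)) (fun j hj => ((hS j).1 hj).2.2)
      (fun j _ k _ hjk => congrArg Prod.fst hjk) fun j hj => ?_
    rw [hS] at hj
    rw [← neg_sub, neg_dvd]
    exact defect_dvd hF hit ht htA (hγi ▸ hv γ hγ) hU hγ hγi hj.1 hj.2.1 hj.2.2
      (hlt γ hγ hγi j hj.1 hj.2.1 hj.2.2)
  choose! q hq using hQ
  -- `y / Q` is the divided difference, and it is again compatible
  have hqc : h.Compatible {γ | γ ∈ F ∧ γ.symm v = i} q := by
    rintro γ hγ a b hab hb hγ'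
    have hiA : i ∈ A := hγ.2 ▸ hv γ hγ.1
    have h1 := defect_compatible hF hit ht htA hiA hU hi γ hγ a b hab hb hγ'
    change _ ∣ y γ - y _ at h1
    rw [hq γ hγ, hq _ hγ', ← mul_sub] at h1
    by_cases hbt : b = t ∧ a ∈ S
    · -- here `X a - X b` divides `Q` as well, and a second order congruence is needed
      obtain ⟨rfl, haS⟩ := hbt
      have haS' := (hS a).1 haS
      have h2 := defect_sq_dvd hF hit ht htA hiA hU hi haS'.1 haS'.2.1 haS'.2.2
        (fun γ hγ hγi => hlt γ hγ hγi a haS'.1 haS'.2.1 haS'.2.2) hγ.1 hγ.2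
      change _ ∣ y γ - y _ at h2
      rw [hq γ hγ, hq _ hγ', ← mul_sub,
        show Q = (X b - X a) * ∏ j ∈ S.erase a, (X b - X j) from
          (Finset.mul_prod_erase S (fun j => X b - X j) haS).symm, sq, mul_assoc] at h2
      have h3 := (mul_dvd_mul_iff_left (prime_X_sub_X hab.ne').ne_zero).1 h2
      rw [← neg_sub, neg_dvd]
      refine ((prime_X_sub_X hab.ne').dvd_or_dvd h3).resolve_left fun h4 => ?_
      rw [(prime_X_sub_X hab.ne').dvd_finsetProd_iff] at h4
      obtain ⟨j, hj, h5⟩ := h4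
      rw [Finset.mem_erase, hS] at hj
      rcases eq_or_eq_of_X_sub_X_dvd hj.2.2.2.ne' h5 with h6 | h6
      · exact hj.1 h6.2
      · exact hab.ne' h6.1
    · refine ((prime_X_sub_X hab.ne).dvd_or_dvd h1).resolve_left fun h4 => ?_
      rw [(prime_X_sub_X hab.ne).dvd_finsetProd_iff] at h4
      obtain ⟨j, hj, h5⟩ := h4
      have hj' := (hS j).1 hj
      rcases eq_or_eq_of_X_sub_X_dvd hj'.2.2.ne' h5 with h6 | h6
      · exact hab.asymm (h6.1 ▸ h6.2 ▸ hj'.2.2)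
      · exact hbt ⟨h6.1.symm, h6.2 ▸ hj⟩
  refine ⟨fun γ => if γ ∈ F ∧ γ.symm v = i then g γ + P * q γ else g γ,
    fun γ hγ => if_neg hγ, ?_, ?_⟩
  · rintro γ hγ a b hab hb hγ'
    simp only
    rw [if_pos (show _ ∧ _ from hγ), if_pos (show _ ∧ _ from hγ'), add_sub_add_comm, ← mul_sub]
    exact dvd_add (hi γ hγ a b hab hb hγ') ((hqc γ hγ a b hab hb hγ').mul_left _)
  · intro γ hγ hγi j hjA hij hjt
    have p1 : (γ * Equiv.swap i j).symm v = j := by rw [mul_swap_symm, hγi, Equiv.swap_apply_left]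
    simp only
    rw [if_pos ⟨hγ, hγi⟩, if_neg (fun hc => hij.ne' (p1.symm.trans hc.2))]
    rcases hjt.lt_or_eq with hjt | rfl
    · rw [add_sub_right_comm]
      exact dvd_add (hlt γ hγ hγi j hjA hij hjt)
        ((Finset.dvd_prod_of_mem _ ((hS j).2 ⟨hjA, hij, hjt⟩)).mul_right _)
    · have h1 : identify i j P = Q := by
        rw [map_prod]
        refine Finset.prod_congr rfl fun k hk => ?_
        rw [map_sub, identify_X_left, identify_X_of_ne j ((hS k).1 hk).2.1.ne']
      have h2 : ∀ f : MvPolynomial (Fin n) ℂ, identify i j (identify i j f) = identify i j f := by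
        intro f
        have := X_sub_X_dvd_iff.1 (X_sub_X_dvd_sub_identify i j f)
        rw [map_sub, sub_eq_zero] at this
        exact this.symm
      have h3 := congrArg (identify i j) (hq γ ⟨hγ, hγi⟩)
      simp only [y] at h3
      rw [h2, map_mul, ← h1, h2] at h3
      rw [X_sub_X_dvd_iff, map_sub, map_add, map_mul]
      rw [map_sub] at h3
      linear_combination -h3

/-- A compatible family on the vertices of a block where `v` is in a position after `i` extends to
the vertices where `v` is in position `i`. -/
theorem exists_extension (hF : IsBlock F A) (hv : ∀ γ ∈ F, γ.symm v ∈ A)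
    (hU : h.Compatible {γ | γ ∈ F ∧ i < γ.symm v} g) :
    ∃ g' : Equiv.Perm (Fin n) → MvPolynomial (Fin n) ℂ,
      (∀ γ, i < γ.symm v → g' γ = g γ) ∧
      h.Compatible {γ | γ ∈ F ∧ i ≤ γ.symm v} g' := by
  classical
  -- the conditions towards the positions `j < T` are achieved by induction on `T`
  have key : ∀ T : ℕ, ∃ g' : Equiv.Perm (Fin n) → MvPolynomial (Fin n) ℂ,
      (∀ γ, i < γ.symm v → g' γ = g γ) ∧
      h.Compatible {γ | γ ∈ F ∧ γ.symm v = i} g' ∧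
      ∀ γ ∈ F, γ.symm v = i → ∀ j ∈ A, i < j → j ≤ h.toFun i → (j : ℕ) < T →
        X i - X j ∣ g' γ - g' (γ * Equiv.swap i j) := by
    intro T
    induction T with
    | zero =>
      refine ⟨fun γ => if i < γ.symm v then g γ else 0, fun γ hγ => if_pos hγ, ?_, ?_⟩
      · rintro γ hγ a b _ _ hγ'
        simp only
        rw [if_neg hγ.2.not_gt, if_neg hγ'.2.not_gt, sub_self]
        exact dvd_zero _
      · intro γ _ _ j _ _ _ hj
        exact absurd hj (Nat.not_lt_zero _)
    | succ T ih =>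
      obtain ⟨g₁, h1, h2, h3⟩ := ih
      by_cases hT : ∃ t : Fin n, (t : ℕ) = T ∧ i < t ∧ t ≤ h.toFun i ∧ t ∈ A
      · obtain ⟨t, rfl, hit, ht, htA⟩ := hT
        have hU₁ : h.Compatible {γ | γ ∈ F ∧ i < γ.symm v} g₁ := by
          rintro γ hγ a b hab hb hγ'
          rw [h1 _ hγ.2, h1 _ hγ'.2]
          exact hU γ hγ a b hab hb hγ'
        obtain ⟨g₂, k1, k2, k3⟩ := exists_newton_step hF hv hit ht htA hU₁ h2
          fun γ hγ hγi j hjA hij hjt => h3 γ hγ hγi j hjA hij (hjt.le.trans ht) hjt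
        refine ⟨g₂, fun γ hγ => ?_, k2, fun γ hγ hγi j hjA hij _ hjt => ?_⟩
        · rw [k1 γ (fun hc => hγ.ne' hc.2), h1 γ hγ]
        · exact k3 γ hγ hγi j hjA hij (Nat.lt_succ_iff.1 hjt)
      · refine ⟨g₁, h1, h2, fun γ hγ hγi j hjA hij hj hjt => ?_⟩
        refine h3 γ hγ hγi j hjA hij hj (lt_of_le_of_ne (Nat.lt_succ_iff.1 hjt) fun hc => ?_)
        exact hT ⟨j, hc, hij, hj, hjA⟩
  obtain ⟨g', h1, h2, h3⟩ := key n
  refine ⟨g', h1, ?_⟩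
  have cross : ∀ γ ∈ F, γ.symm v = i → ∀ a b, a < b → b ≤ h.toFun a → γ * Equiv.swap a b ∈ F →
      i < (γ * Equiv.swap a b).symm v → X a - X b ∣ g' γ - g' (γ * Equiv.swap a b) := by
    intro γ hγ hγi a b hab hb hγ' hlt
    obtain ⟨rfl, -⟩ := swap_eq_of_lt hγi hab hlt
    exact h3 γ hγ hγi b ((hF γ hγ a b hab.ne).1 hγ').2 hab hb b.2
  rintro γ ⟨hγ, hγi⟩ a b hab hb ⟨hγ', hγi'⟩
  rcases hγi.eq_or_lt with e1 | e1 <;> rcases hγi'.eq_or_lt with e2 | e2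
  · exact h2 γ ⟨hγ, e1.symm⟩ a b hab hb ⟨hγ', e2.symm⟩
  · exact cross γ hγ e1.symm a b hab hb hγ' e2
  · have := cross _ hγ' e2.symm a b hab hb (by rwa [mul_mul_cancel_swap])
      (by rwa [mul_mul_cancel_swap])
    rwa [mul_mul_cancel_swap, dvd_sub_comm] at this
  · rw [h1 _ e1, h1 _ e2]
    exact hU γ ⟨hγ, e1⟩ a b hab hb ⟨hγ', e2⟩

end Extension

/-! ### Flow-up classes -/

/-- The permutations which agree with `β` at the positions of all values `≥ m`. -/
def block (β : Equiv.Perm (Fin n)) (m : ℕ) : Set (Equiv.Perm (Fin n)) :=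
  {γ | ∀ i, m ≤ (β i : ℕ) → γ i = β i}

theorem lt_iff_of_mem_block {β γ : Equiv.Perm (Fin n)} {m : ℕ} (hγ : γ ∈ block β m) (i : Fin n) :
    (γ i : ℕ) < m ↔ (β i : ℕ) < m := by
  constructor
  · intro h1
    by_contra h2
    rw [hγ i (not_lt.1 h2)] at h1
    exact h2 h1
  · intro h1
    by_contra h2
    have h3 : m ≤ (β (β.symm (γ i)) : ℕ) := by rw [Equiv.apply_symm_apply]; exact not_lt.1 h2
    have h4 := hγ _ h3
    rw [Equiv.apply_symm_apply] at h4
    have h5 := γ.injective h4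
    rw [h5] at h3
    exact absurd h1 (not_lt.2 h3)

theorem isBlock_block (β : Equiv.Perm (Fin n)) (m : ℕ) :
    IsBlock (block β m) {i | (β i : ℕ) < m} := by
  intro γ hγ a b hab
  constructor
  · intro h1
    constructor
    · by_contra h2
      have h2 : m ≤ (β a : ℕ) := not_lt.1 h2
      have h3 := h1 a h2
      rw [Equiv.Perm.mul_apply, Equiv.swap_apply_left, ← hγ a h2] at h3
      exact hab (γ.injective h3).symm
    · by_contra h2
      have h2 : m ≤ (β b : ℕ) := not_lt.1 h2
      have h3 := h1 b h2
      rw [Equiv.Perm.mul_apply, Equiv.swap_apply_right, ← hγ b h2] at h3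
      exact hab (γ.injective h3)
  · rintro ⟨h1, h2⟩ i hi
    rw [Equiv.Perm.mul_apply, Equiv.swap_apply_of_ne_of_ne, hγ i hi]
    · rintro rfl; exact absurd h1 (not_lt.2 hi)
    · rintro rfl; exact absurd h2 (not_lt.2 hi)

/-- The order on permutations which compares the positions of the values from the largest one
down: `γ` is before `β` if the largest value in different positions is further to the right
in `γ`. -/
def Precedes (γ β : Equiv.Perm (Fin n)) : Prop :=
  ∃ v, (∀ u, v < u → γ.symm u = β.symm u) ∧ β.symm v < γ.symm v

variable (h) in
open Classical in
/-- The pairs of positions `i < j ≤ h(i)` which are inversions of `β`, the larger value being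
less than `m`. -/
def hInversions (β : Equiv.Perm (Fin n)) (m : ℕ) : Finset (Fin n × Fin n) :=
  {e | e.1 < e.2 ∧ e.2 ≤ h.toFun e.1 ∧ β e.2 < β e.1 ∧ (β e.1 : ℕ) < m}

theorem mem_hInversions {β : Equiv.Perm (Fin n)} {m : ℕ} {e : Fin n × Fin n} :
    e ∈ h.hInversions β m ↔
      e.1 < e.2 ∧ e.2 ≤ h.toFun e.1 ∧ β e.2 < β e.1 ∧ (β e.1 : ℕ) < m := by
  simp [hInversions]

theorem compatible_const_mul {U : Set (Equiv.Perm (Fin n))}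
    {g : Equiv.Perm (Fin n) → MvPolynomial (Fin n) ℂ} (hg : h.Compatible U g)
    (f : MvPolynomial (Fin n) ℂ) : h.Compatible U fun γ => f * g γ := by
  intro γ hγ a b hab hb hγ'
  simp only
  rw [← mul_sub]
  exact (hg γ hγ a b hab hb hγ').mul_left _

/-- On each block there is a compatible family which vanishes before `β` and whose value at `β`
is the product of the labels of the edges ending in `β`. -/
theorem exists_flowUp_block (m : ℕ) (hm : m ≤ n) (β : Equiv.Perm (Fin n)) :
    ∃ g : Equiv.Perm (Fin n) → MvPolynomial (Fin n) ℂ, h.Compatible (block β m) g ∧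
      g β = ∏ e ∈ h.hInversions β m, (X e.1 - X e.2) ∧
      ∀ γ ∈ block β m, Precedes γ β → g γ = 0 := by
  classical
  induction m with
  | zero =>
    have h0 : ∀ γ ∈ block β 0, γ = β := fun γ hγ => Equiv.ext fun i => hγ i (Nat.zero_le _)
    refine ⟨fun _ => 1, fun γ _ i j _ _ _ => by simp, ?_, ?_⟩
    · rw [Finset.prod_eq_one]
      intro e he
      exact absurd (mem_hInversions.1 he).2.2.2 (Nat.not_lt_zero _)
    · rintro γ hγ ⟨v, -, hv⟩
      rw [h0 γ hγ] at hv
      exact absurd hv (lt_irrefl _)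
  | succ m ih =>
    obtain ⟨g₀, hc, hβ, h0⟩ := ih (Nat.le_of_succ_le hm)
    let v : Fin n := ⟨m, hm⟩
    set p : Fin n := β.symm v with hp
    have hpv : β p = v := by rw [hp, Equiv.apply_symm_apply]
    set A : Set (Fin n) := {i | (β i : ℕ) < m + 1}
    have hF : IsBlock (block β (m + 1)) A := isBlock_block β (m + 1)
    have hv : ∀ γ ∈ block β (m + 1), γ.symm v ∈ A := by
      intro γ hγ
      change (β _ : ℕ) < m + 1
      rw [← lt_iff_of_mem_block hγ, Equiv.apply_symm_apply]
      exact Nat.lt_succ_self m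
    have hsub : ∀ γ, γ ∈ block β m ↔ γ ∈ block β (m + 1) ∧ γ.symm v = p := by
      intro γ
      constructor
      · intro hγ
        refine ⟨fun i hi => hγ i (Nat.le_of_succ_le hi), ?_⟩
        rw [Equiv.symm_apply_eq, hγ p (by rw [hpv]), hpv]
      · rintro ⟨hγ, hγp⟩ i hi
        rcases hi.lt_or_eq with hi | hi
        · exact hγ i hi
        · have h1 : β i = v := Fin.ext hi.symm
          have h2 : i = p := by rw [hp, ← h1, Equiv.symm_apply_apply]
          rw [h1, h2, ← hγp, Equiv.apply_symm_apply]
    -- `P` is constant in `R`-coordinates, so multiplication by it preserves compatibility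
    let S : Finset (Fin n) := {j | p < j ∧ j ≤ h.toFun p ∧ (β j : ℕ) < m}
    let P : MvPolynomial (Fin n) ℂ := ∏ j ∈ S, (X p - X j)
    let g₁ := fun γ => if γ ∈ block β m then P * g₀ γ else 0
    have hcross : ∀ γ ∈ block β m, ∀ a b, a < b → b ≤ h.toFun a →
        γ * Equiv.swap a b ∈ block β (m + 1) → p < (γ * Equiv.swap a b).symm v →
        X a - X b ∣ P * g₀ γ := by
      intro γ hγ a b hab hb hγ' hlt
      obtain ⟨hγ1, hγp⟩ := (hsub γ).1 hγ
      obtain ⟨rfl, -⟩ := swap_eq_of_lt hγp hab hlt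
      refine (Finset.dvd_prod_of_mem (fun j => X p - X j) ?_).mul_right _
      simp only [S, Finset.mem_filter, Finset.mem_univ, true_and]
      refine ⟨hab, hb, ?_⟩
      have h1 : (β b : ℕ) < m + 1 := ((hF γ hγ1 p b hab.ne).1 hγ').2
      refine lt_of_le_of_ne (Nat.lt_succ_iff.1 h1) fun hc => hab.ne' ?_
      rw [hp, ← show β b = v from Fin.ext hc, Equiv.symm_apply_apply]
    have hg₁ : h.Compatible {γ | γ ∈ block β (m + 1) ∧ p ≤ γ.symm v} g₁ := by
      rintro γ ⟨hγ, hγp⟩ a b hab hb ⟨hγ', hγp'⟩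
      simp only [g₁]
      by_cases e1 : γ ∈ block β m <;> by_cases e2 : γ * Equiv.swap a b ∈ block β m
      · rw [if_pos e1, if_pos e2]
        exact compatible_const_mul hc P γ e1 a b hab hb e2
      · rw [if_pos e1, if_neg e2, sub_zero]
        exact hcross γ e1 a b hab hb hγ'
          (lt_of_le_of_ne hγp' fun hc => e2 ((hsub _).2 ⟨hγ', hc.symm⟩))
      · rw [if_neg e1, if_pos e2, zero_sub, dvd_neg]
        exact hcross _ e2 a b hab hb (by rwa [mul_mul_cancel_swap]) (by
          rw [mul_mul_cancel_swap]
          exact lt_of_le_of_ne hγp fun hc => e1 ((hsub _).2 ⟨hγ, hc.symm⟩))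
      · rw [if_neg e1, if_neg e2, sub_self]
        exact dvd_zero _
    -- extension to the vertices with `v` in position `p - k`, for increasing `k`
    have hext : ∀ k : ℕ, k ≤ p → ∃ g : Equiv.Perm (Fin n) → MvPolynomial (Fin n) ℂ,
        (∀ γ, p ≤ γ.symm v → g γ = g₁ γ) ∧
        h.Compatible {γ | γ ∈ block β (m + 1) ∧ (p : ℕ) ≤ γ.symm v + k} g := by
      intro k hk
      induction k with
      | zero => exact ⟨g₁, fun _ _ => rfl, by simpa using hg₁⟩
      | succ k ih =>
        obtain ⟨g₂, h1, h2⟩ := ih (Nat.le_of_succ_le hk)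
        let i : Fin n := ⟨p - (k + 1), by omega⟩
        have hi : (i : ℕ) = p - (k + 1) := rfl
        have hset : {γ | γ ∈ block β (m + 1) ∧ (p : ℕ) ≤ γ.symm v + k} =
            {γ | γ ∈ block β (m + 1) ∧ i < γ.symm v} := by
          ext γ
          simp only [Set.mem_ofPred_eq, Fin.lt_def, hi]
          constructor <;> rintro ⟨h3, h4⟩ <;> exact ⟨h3, by omega⟩
        have hset' : {γ | γ ∈ block β (m + 1) ∧ (p : ℕ) ≤ γ.symm v + (k + 1)} =
            {γ | γ ∈ block β (m + 1) ∧ i ≤ γ.symm v} := by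
          ext γ
          simp only [Set.mem_ofPred_eq, Fin.le_def, hi]
          constructor <;> rintro ⟨h3, h4⟩ <;> exact ⟨h3, by omega⟩
        rw [hset] at h2
        obtain ⟨g₃, h3, h4⟩ := exists_extension hF hv h2
        refine ⟨g₃, fun γ hγ => ?_, by rwa [hset']⟩
        rw [h3 γ, h1 γ hγ]
        rw [Fin.lt_def, hi]
        rw [Fin.le_def] at hγ
        omega
    obtain ⟨g, h1, h2⟩ := hext p le_rfl
    have hset : {γ | γ ∈ block β (m + 1) ∧ (p : ℕ) ≤ γ.symm v + (p : ℕ)} = block β (m + 1) := by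
      ext γ
      simp
    rw [hset] at h2
    refine ⟨g, h2, ?_, ?_⟩
    · rw [h1 β le_rfl]
      have hβm : β ∈ block β m := fun _ _ => rfl
      simp only [g₁]
      rw [if_pos hβm, hβ]
      have h3 : h.hInversions β (m + 1) = S.image (fun j => (p, j)) ∪ h.hInversions β m := by
        ext ⟨i, j⟩
        rw [Finset.mem_union, mem_hInversions, mem_hInversions, Finset.mem_image]
        simp only [S, Finset.mem_filter, Finset.mem_univ, true_and, Prod.mk.injEq]
        constructor
        · rintro ⟨h4, h5, h6, h7⟩
          rcases (Nat.lt_succ_iff.1 h7).lt_or_eq with h8 | h8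
          · exact Or.inr ⟨h4, h5, h6, h8⟩
          · have h9 : i = p := by rw [hp, ← show β i = v from Fin.ext h8, Equiv.symm_apply_apply]
            subst h9
            refine Or.inl ⟨j, ⟨h4, h5, ?_⟩, rfl, rfl⟩
            rw [hpv, Fin.lt_def] at h6
            exact h6
        · rintro (⟨j', ⟨h4, h5, h6⟩, rfl, rfl⟩ | ⟨h4, h5, h6, h7⟩)
          · refine ⟨h4, h5, ?_, ?_⟩
            · rw [hpv, Fin.lt_def]; exact h6
            · rw [hpv]; exact Nat.lt_succ_self m
          · exact ⟨h4, h5, h6, Nat.lt_succ_of_lt h7⟩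
      rw [h3, Finset.prod_union, Finset.prod_image]
      · exact fun j _ k _ hjk => congrArg Prod.snd hjk
      · rw [Finset.disjoint_left]
        intro e he he'
        obtain ⟨j, -, rfl⟩ := Finset.mem_image.1 he
        have := (mem_hInversions.1 he').2.2.2
        simp only [hpv] at this
        exact lt_irrefl _ this
    · rintro γ hγ ⟨w, hw, hwlt⟩
      have hwv : w ≤ v := by
        by_contra hc
        rw [not_le] at hc
        have h3 : γ (β.symm w) = β (β.symm w) := hγ _ (by
          rw [Equiv.apply_symm_apply]; exact hc)
        rw [Equiv.apply_symm_apply, ← Equiv.eq_symm_apply] at h3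
        exact hwlt.ne h3
      have hle : p ≤ γ.symm v := by
        rcases hwv.lt_or_eq with h3 | rfl
        · exact (hw v h3).ge
        · exact hwlt.le
      rw [h1 γ hle]
      simp only [g₁]
      split_ifs with h3
      · rw [h0 γ h3 ⟨w, hw, hwlt⟩, mul_zero]
      · rfl

theorem X_sub_X_dvd_homogeneousComponent {i j : Fin n} {f : MvPolynomial (Fin n) ℂ} (d : ℕ)
    (hf : X i - X j ∣ f) : X i - X j ∣ homogeneousComponent d f := by
  rw [X_sub_X_dvd_iff, identify] at hf ⊢
  rw [rename_homogeneousComponent, hf, map_zero]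

theorem rename_rightCoord (β : Equiv.Perm (Fin n)) (x : BigRing n) :
    rename β (BigRing.rightCoord β x) = x β := by
  rw [BigRing.rightCoord_apply, rename_rename]
  simp

theorem rightCoord_eq_zero_iff {β : Equiv.Perm (Fin n)} {x : BigRing n} :
    BigRing.rightCoord β x = 0 ↔ x β = 0 := by
  rw [BigRing.rightCoord_apply, map_eq_zero_iff _ (rename_injective _ β.symm.injective)]

/-- An element of `𝒯_h`, given by a compatible family of `R`-coordinates. -/
noncomputable def ofCompatible (g : Equiv.Perm (Fin n) → MvPolynomial (Fin n) ℂ)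
    (hg : h.Compatible Set.univ g) : h.smallRing :=
  ⟨fun β => rename β (g β), by
    rintro β β' i j ⟨hij, hj, -, rfl⟩
    have h1 : ∀ γ, BigRing.rightCoord γ (fun β => rename β (g β)) = g γ := by
      intro γ
      rw [BigRing.rightCoord_apply, rename_rename]
      simp
    rw [h1, h1]
    exact hg β trivial i j hij hj trivial⟩

/-- The edge conditions of `𝒯_h` without the orientation of the edges. -/
theorem compatible_rightCoord (x : h.smallRing) :
    h.Compatible Set.univ fun β => BigRing.rightCoord β (x : BigRing n) := by
  intro β _ i j hij hj _
  rcases lt_or_gt_of_ne (β.injective.ne hij.ne) with h1 | h1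
  · exact x.2 β _ i j ⟨hij, hj, h1, rfl⟩
  · have := x.2 (β * Equiv.swap i j) β i j ⟨hij, hj, by simpa using h1,
      (mul_mul_cancel_swap β i j).symm⟩
    rwa [dvd_sub_comm] at this

theorem hInversions_eq (β : Equiv.Perm (Fin n)) (e : Fin n × Fin n) :
    e ∈ h.hInversions β n ↔ e.1 < e.2 ∧ e.2 ≤ h.toFun e.1 ∧ β e.2 < β e.1 := by
  rw [mem_hInversions]
  exact ⟨fun h1 => ⟨h1.1, h1.2.1, h1.2.2.1⟩, fun h1 => ⟨h1.1, h1.2.1, h1.2.2, (β e.1).2⟩⟩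

variable (h) in
/-- The product of the labels `L_{β i} - L_{β j}` of the edges of `M(h)` ending in `β`, in
`L`-coordinates. -/
noncomputable def inversionProd (β : Equiv.Perm (Fin n)) : MvPolynomial (Fin n) ℂ :=
  rename β (∏ e ∈ h.hInversions β n, (X e.1 - X e.2))

theorem isHomogeneous_prod_hInversions (β : Equiv.Perm (Fin n)) :
    (∏ e ∈ h.hInversions β n, (X e.1 - X e.2 : MvPolynomial (Fin n) ℂ)).IsHomogeneous
      (h.hInversions β n).card := by
  rw [Finset.card_eq_sum_ones]
  exact IsHomogeneous.prod _ _ _ fun e _ => (isHomogeneous_X _ _).sub (isHomogeneous_X _ _)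

theorem inversionProd_ne_zero (β : Equiv.Perm (Fin n)) : h.inversionProd β ≠ 0 := by
  rw [inversionProd, Ne, map_eq_zero_iff _ (rename_injective _ β.injective),
    Finset.prod_eq_zero_iff]
  rintro ⟨e, he, h1⟩
  exact (prime_X_sub_X ((hInversions_eq β e).1 he).1.ne).ne_zero h1

/-- An element of `𝒯_h` which vanishes before `β` is divisible at `β` by the labels of the edges
ending in `β`. -/
theorem inversionProd_dvd {β : Equiv.Perm (Fin n)} {x : h.smallRing}
    (hx : ∀ γ, Precedes γ β → (x : BigRing n) γ = 0) : h.inversionProd β ∣ (x : BigRing n) β := by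
  rw [inversionProd, ← rename_rightCoord β x]
  refine map_dvd (rename β) ?_
  refine prod_X_sub_X_dvd (e := id) (fun e he => ((hInversions_eq β e).1 he).1)
    Function.injective_id.injOn fun e he => ?_
  obtain ⟨h1, h2, h3⟩ := (hInversions_eq β e).1 he
  have h4 := compatible_rightCoord x β trivial e.1 e.2 h1 h2 trivial
  have h5 : BigRing.rightCoord (β * Equiv.swap e.1 e.2) (x : BigRing n) = 0 := by
    rw [rightCoord_eq_zero_iff]
    refine hx _ ⟨β e.1, fun u hu => ?_, ?_⟩
    · rw [mul_swap_symm, Equiv.swap_apply_of_ne_of_ne]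
      · rintro h6
        rw [Equiv.symm_apply_eq] at h6
        exact hu.ne' h6
      · rintro h6
        rw [Equiv.symm_apply_eq] at h6
        rw [h6] at hu
        exact hu.asymm h3
    · rw [mul_swap_symm, Equiv.symm_apply_apply, Equiv.swap_apply_left]
      exact h1
  simp only [h5, sub_zero] at h4
  exact h4

variable (h) in
/-- Homogeneous flow-up classes: elements of `𝒯_h` which are triangular for the order `Precedes`,
with the smallest possible diagonal entries. -/
theorem exists_flowUp (β : Equiv.Perm (Fin n)) :
    ∃ x : h.smallRing, h.IsHomogeneous (h.hInversions β n).card x ∧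
      (x : BigRing n) β = h.inversionProd β ∧
      ∀ γ, Precedes γ β → (x : BigRing n) γ = 0 := by
  obtain ⟨g, hg, h1, h2⟩ := h.exists_flowUp_block n le_rfl β
  have hblock : ∀ γ, γ ∈ block β n := fun γ i hi => absurd (β i).2 (not_lt.2 hi)
  refine ⟨ofCompatible (fun γ => homogeneousComponent (h.hInversions β n).card (g γ)) ?_,
    ?_, ?_, ?_⟩
  · intro γ _ i j hij hj _
    simp only
    rw [← map_sub]
    exact X_sub_X_dvd_homogeneousComponent _ (hg γ (hblock γ) i j hij hj (hblock _))
  · exact fun γ => (homogeneousComponent_isHomogeneous _ _).rename_isHomogeneous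
  · change rename β (homogeneousComponent _ (g β)) = _
    rw [h1, homogeneousComponent_eq_self (isHomogeneous_prod_hInversions β), inversionProd]
  · intro γ hγ
    change rename γ (homogeneousComponent _ (g γ)) = 0
    rw [h2 γ (hblock γ) hγ, map_zero, map_zero]

/-! ### Homogeneous bases -/

/-- The positions of the values, from the largest value down and compared from the right: an
injection into a linear order which turns `Precedes` into `<`. -/
def precedesKey (β : Equiv.Perm (Fin n)) : Lex (Fin n → (Fin n)ᵒᵈ) :=
  toLex fun v => OrderDual.toDual (β.symm v.rev)

theorem precedesKey_injective : Function.Injective (precedesKey (n := n)) := by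
  intro β γ hβγ
  have h1 : ∀ v, β.symm v = γ.symm v := by
    intro v
    have := congrFun (toLex.injective hβγ) v.rev
    simpa using this
  have h2 : β.symm = γ.symm := Equiv.ext h1
  rw [← β.symm_symm, h2, γ.symm_symm]

theorem precedes_iff {γ β : Equiv.Perm (Fin n)} :
    Precedes γ β ↔ precedesKey γ < precedesKey β := by
  change _ ↔ Pi.Lex _ _ _ _
  constructor
  · rintro ⟨v, h1, h2⟩
    refine ⟨v.rev, fun u hu => ?_, ?_⟩
    · exact congrArg OrderDual.toDual (h1 _ (by rwa [Fin.lt_rev_iff]))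
    · change β.symm v.rev.rev < γ.symm v.rev.rev
      rwa [Fin.rev_rev]
  · rintro ⟨v, h1, h2⟩
    refine ⟨v.rev, fun u hu => ?_, h2⟩
    have := h1 u.rev (Fin.rev_lt_iff.2 hu)
    have h3 : γ.symm u.rev.rev = β.symm u.rev.rev := OrderDual.toDual.injective this
    rwa [Fin.rev_rev] at h3

variable (h) in
/-- A subalgebra of `𝒯_h` all of whose coordinate maps to the polynomial ring are bijective,
such as `ℂ[L]` and `ℂ[R]`. -/
def IsDiagonal (A : Subalgebra ℂ h.smallRing) : Prop :=
  ∀ β, Function.Bijective fun a : A => ((a : h.smallRing) : BigRing n) β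

theorem isDiagonal_leftBase : h.IsDiagonal h.leftBase := by
  intro β
  constructor
  · rintro ⟨_, f, rfl⟩ ⟨_, g, rfl⟩ hfg
    have hfg : f = g := hfg
    rw [hfg]
  · exact fun f => ⟨⟨_, f, rfl⟩, rfl⟩

theorem isDiagonal_rightBase : h.IsDiagonal h.rightBase := by
  intro β
  constructor
  · rintro ⟨_, f, rfl⟩ ⟨_, g, rfl⟩ hfg
    have hfg : rename β f = rename β g := hfg
    rw [rename_injective _ β.injective hfg]
  · intro f
    refine ⟨⟨_, rename β.symm f, rfl⟩, ?_⟩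
    change rename β (rename β.symm f) = f
    rw [rename_rename]
    simp

/-- By triangularity, the flow-up classes form a basis of `𝒯_h` over every diagonal subalgebra. -/
theorem nonempty_homogeneousBasis {A : Subalgebra ℂ h.smallRing} (hA : h.IsDiagonal A) :
    Nonempty (h.HomogeneousBasis A (Fin n.factorial)) := by
  classical
  choose e he1 he2 he3 using h.exists_flowUp
  have ev_zero : ∀ (a : A) β, ((a : h.smallRing) : BigRing n) β = 0 → a = 0 := by
    intro a β ha
    exact (hA β).1 (ha.trans rfl)
  have ev_sum : ∀ (s : Finset (Equiv.Perm (Fin n))) (c : Equiv.Perm (Fin n) → A) β,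
      ((∑ γ ∈ s, c γ • e γ : h.smallRing) : BigRing n) β =
        ∑ γ ∈ s, ((c γ : h.smallRing) : BigRing n) β * (e γ : BigRing n) β := by
    intro s c β
    rw [AddSubmonoidClass.coe_finsetSum, Finset.sum_apply]
    rfl
  have hli : LinearIndependent A e := by
    refine (Fintype.linearIndependent_iff (ι := Equiv.Perm (Fin n)) (R := A)
      (v := e)).2 fun c hc => ?_
    by_contra! hne
    obtain ⟨β, hβ, hmin⟩ := Finset.exists_min_image
      (Finset.univ.filter fun γ => c γ ≠ 0) precedesKey (by simpa [Finset.Nonempty] using hne)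
    rw [Finset.mem_filter] at hβ
    have h1 := ev_sum Finset.univ c β
    rw [hc, Finset.sum_eq_single β] at h1
    · rcases mul_eq_zero.1 h1.symm with h2 | h2
      · exact hβ.2 (ev_zero _ β h2)
      · rw [he2] at h2
        exact inversionProd_ne_zero β h2
    · intro γ _ hγ
      by_cases h2 : c γ = 0
      · rw [h2]; exact zero_mul _
      · have h3 := hmin γ (Finset.mem_filter.2 ⟨Finset.mem_univ _, h2⟩)
        rw [he3 γ β (precedes_iff.2 (lt_of_le_of_ne h3 (precedesKey_injective.ne hγ.symm))),
          mul_zero]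
    · exact fun h2 => absurd (Finset.mem_univ β) h2
  have hspan : ⊤ ≤ Submodule.span A (Set.range e) := by
    -- subtracting a multiple of a flow-up class removes the first vertex of the support, so the
    -- number of vertices at or after the first one in the support decreases
    have key : ∀ (N : ℕ) (x : h.smallRing),
        (Finset.univ.filter fun β : Equiv.Perm (Fin n) =>
          ∃ γ, (γ = β ∨ Precedes γ β) ∧ (x : BigRing n) γ ≠ 0).card = N →
        x ∈ Submodule.span A (Set.range e) := by
      intro N
      induction N using Nat.strong_induction_on with
      | _ N ih =>
        intro x hx
        by_cases hx0 : x = 0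
        · rw [hx0]; exact Submodule.zero_mem _
        have hne : (Finset.univ.filter fun β : Equiv.Perm (Fin n) =>
            (x : BigRing n) β ≠ 0).Nonempty := by
          by_contra hc
          rw [Finset.not_nonempty_iff_eq_empty, Finset.filter_eq_empty_iff] at hc
          exact hx0 (Subtype.ext (funext fun β => not_not.1 (hc (Finset.mem_univ β))))
        obtain ⟨β, hβ, hmin⟩ := Finset.exists_min_image _ precedesKey hne
        rw [Finset.mem_filter] at hβ
        have hzero : ∀ γ, Precedes γ β → (x : BigRing n) γ = 0 := by
          intro γ hγ
          by_contra hc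
          exact absurd (hmin γ (Finset.mem_filter.2 ⟨Finset.mem_univ _, hc⟩))
            (not_le.2 (precedes_iff.1 hγ))
        obtain ⟨f, hf⟩ := inversionProd_dvd hzero
        obtain ⟨a, ha⟩ := (hA β).2 f
        have h1 : x = (x - a • e β) + a • e β := by rw [sub_add_cancel]
        rw [h1]
        refine Submodule.add_mem _ (ih _ ?_ _ rfl)
          (Submodule.smul_mem _ _ (Submodule.subset_span ⟨β, rfl⟩))
        rw [← hx]
        have hz : ∀ γ, (γ = β ∨ Precedes γ β) →
            ((x - a • e β : h.smallRing) : BigRing n) γ = 0 := by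
          have h2 : ∀ γ, ((x - a • e β : h.smallRing) : BigRing n) γ =
            (x : BigRing n) γ - ((a : h.smallRing) : BigRing n) γ * (e β : BigRing n) γ :=
              fun γ => rfl
          rintro γ (rfl | hγ)
          · rw [h2, he2, hf, ← ha]
            ring
          · rw [h2, hzero γ hγ, he3 β γ hγ, mul_zero, sub_zero]
        refine Finset.card_lt_card (Finset.ssubset_iff_of_subset ?_ |>.2 ⟨β, ?_, ?_⟩)
        · intro γ hγ
          rw [Finset.mem_filter] at hγ ⊢
          obtain ⟨-, δ, h3, h4⟩ := hγ
          refine ⟨Finset.mem_univ _, β, ?_, hβ.2⟩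
          have h5 : ¬ (δ = β ∨ Precedes δ β) := fun hc => h4 (hz δ hc)
          have h6 : precedesKey β < precedesKey δ := by
            rw [precedes_iff, not_or] at h5
            exact lt_of_le_of_ne (not_lt.1 h5.2) (precedesKey_injective.ne (Ne.symm h5.1))
          right
          rw [precedes_iff]
          rcases h3 with rfl | h3
          · exact h6
          · exact h6.trans (precedes_iff.1 h3)
        · exact Finset.mem_filter.2 ⟨Finset.mem_univ _, β, Or.inl rfl, hβ.2⟩
        · rw [Finset.mem_filter]
          rintro ⟨-, δ, h3, h4⟩
          exact h4 (hz δ h3)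
    exact fun x _ => key _ x rfl
  have hcard : Fintype.card (Equiv.Perm (Fin n)) = n.factorial := by
    rw [Fintype.card_perm, Fintype.card_fin]
  let ε : Equiv.Perm (Fin n) ≃ Fin n.factorial := Fintype.equivFinOfCardEq hcard
  refine ⟨⟨(Module.Basis.mk hli hspan).reindex ε, fun i => (h.hInversions (ε.symm i) n).card,
    fun i => ?_⟩⟩
  rw [Module.Basis.reindex_apply, Module.Basis.mk_apply]
  exact he1 _

end HessenbergFunction

/-! ### The convolution `id * (S ∘ E_q)` -/

namespace SymFun

variable {K : Type*} [Field K] [CharZero K]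

theorem scale_prod_p (c : ℕ → K) (s : Multiset ℕ) (hs : ∀ k ∈ s, 0 < k) :
    scale c (s.map (p K)).prod = (s.map c).prod • (s.map (p K)).prod := by
  induction s using Multiset.induction_on with
  | empty => simp
  | cons a s ih =>
    rw [Multiset.map_cons, Multiset.map_cons, Multiset.prod_cons, Multiset.prod_cons, map_mul,
      scale_p c (hs a (Multiset.mem_cons_self a s)),
      ih fun k hk => hs k (Multiset.mem_cons_of_mem hk), smul_mul_smul_comm]

end SymFun

theorem AlgHom.convMul_apply_of_primitive {K C B : Type*} [CommSemiring K] [Semiring C]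
    [CommSemiring B] [Bialgebra K C] [Algebra K B] (f g : C →ₐ[K] B) {x : C}
    (hx : Coalgebra.comul (R := K) x = x ⊗ₜ[K] (1 : C) + (1 : C) ⊗ₜ[K] x) :
    (WithConv.toConv f * WithConv.toConv g).ofConv x = f x + g x := by
  change (WithConv.toConv f * WithConv.toConv g) x = _
  rw [AlgHom.convMul_apply, hx, map_add, Algebra.TensorProduct.lift_tmul,
    Algebra.TensorProduct.lift_tmul, map_one, map_one, mul_one, one_mul]

/-- The convolution product of two algebra maps into a commutative algebra is an algebra map, and
it adds their values on the power sums. -/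
theorem SymFun.scale_eq_convMul {K : Type*} [Field K] [CharZero K] (t : K) (f : SymFun K) :
    SymFun.scale (fun k : ℕ => 1 - t ^ k) f =
      (WithConv.toConv (LinearMap.id : SymFun K →ₗ[K] SymFun K) *
        WithConv.toConv (HopfAlgebra.antipode K ∘ₗ (SymFun.eulerian t).toLinearMap)).ofConv f := by
  let E : SymFun K →ₐ[K] SymFun K := SymFun.eulerian t
  let ψ := WithConv.toConv (AlgHom.id K (SymFun K)) * WithConv.toConv (SymFun.antipodeHom.comp E)
  have h1 : (SymFun.scale (fun k : ℕ => 1 - t ^ k) : SymFun K →ₐ[K] SymFun K) = ψ.ofConv := by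
    refine SymFun.hom_ext fun k hk => ?_
    have h2 : E (SymFun.p K k) = t ^ k • SymFun.p K k := SymFun.scale_p _ hk
    have h3 := AlgHom.convMul_apply_of_primitive (AlgHom.id K (SymFun K))
      (SymFun.antipodeHom.comp E) (SymFun.comul_p hk)
    have h4 : SymFun.scale (fun k : ℕ => 1 - t ^ k) (SymFun.p K k) =
      (1 - t ^ k) • SymFun.p K k := SymFun.scale_p _ hk
    rw [h3]
    refine h4.trans ?_
    rw [AlgHom.id_apply, AlgHom.comp_apply, h2, map_smul, SymFun.antipodeHom_p hk, smul_neg,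
      sub_smul, one_smul, sub_eq_add_neg]
  exact DFunLike.congr_fun h1 f

theorem scale_eq_idConvAntipodeEulerian (f : SymFun (RatFunc ℂ)) :
    SymFun.scale (fun k : ℕ => 1 - RatFunc.X ^ k) f = idConvAntipodeEulerian f :=
  SymFun.scale_eq_convMul RatFunc.X f

namespace HessenbergFunction

open MvPolynomial

variable {n : ℕ} {h : HessenbergFunction n}

theorem scale_frob (c : ℕ → RatFunc ℂ) {A : Subalgebra ℂ h.smallRing} {ι : Type*} [Fintype ι]
    (e : h.HomogeneousBasis A ι) :
    SymFun.scale c (frob e) = ((n.factorial : RatFunc ℂ)⁻¹) • ∑ w : Equiv.Perm (Fin n),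
      (gradedTrace e w * (w.partition.parts.map c).prod) •
        (w.partition.parts.map (SymFun.p (RatFunc ℂ))).prod := by
  rw [frob, map_smul, map_sum]
  congr 1
  refine Finset.sum_congr rfl fun w _ => ?_
  rw [map_smul, SymFun.scale_prod_p c _ fun k hk => w.partition.parts_pos hk, smul_smul]

/-! ### Graded traces -/

theorem isHomogeneous_smul {d : ℕ} {x : h.smallRing} (hx : h.IsHomogeneous d x) (c : ℂ) :
    h.IsHomogeneous d (c • x) := fun β =>
  (homogeneousSubmodule (Fin n) ℂ d).smul_mem c (hx β)

theorem isHomogeneous_sum {d : ℕ} {ι : Type*} {s : Finset ι} {x : ι → h.smallRing}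
    (hx : ∀ i ∈ s, h.IsHomogeneous d (x i)) : h.IsHomogeneous d (∑ i ∈ s, x i) := by
  intro β
  rw [AddSubmonoidClass.coe_finsetSum, Finset.sum_apply]
  exact IsHomogeneous.sum _ _ _ fun i hi => hx i hi β

theorem isHomogeneous_dot {d : ℕ} {x : h.smallRing} (hx : h.IsHomogeneous d x)
    (w : Equiv.Perm (Fin n)) : h.IsHomogeneous d (h.dot w x) := fun β =>
  (hx (w⁻¹ * β)).rename_isHomogeneous

/-- In a homogeneous `ℂ`-basis, the expansion of a homogeneous element only involves basis
elements of the same degree. -/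
theorem repr_eq_zero_of_isHomogeneous {I : Type*} (B : Module.Basis I ℂ h.smallRing) {deg : I → ℕ}
    (hB : ∀ i, h.IsHomogeneous (deg i) (B i)) {d : ℕ} {x : h.smallRing} (hx : h.IsHomogeneous d x)
    {i : I} (hi : deg i ≠ d) : B.repr x i = 0 := by
  classical
  let l₁ := (B.repr x).filter fun i => deg i = d
  let l₂ := (B.repr x).filter fun i => ¬ deg i = d
  have hl : l₁ + l₂ = B.repr x := Finsupp.filter_add_filter_not _ _
  set y := Finsupp.linearCombination ℂ B l₂ with hy
  have hxy : y = x - Finsupp.linearCombination ℂ B l₁ := by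
    rw [hy, eq_sub_iff_add_eq', ← map_add, hl, B.linearCombination_repr]
  -- `y` has both degree `d` and no component of degree `d`
  have hyd : h.IsHomogeneous d y := by
    intro β
    rw [hxy]
    refine IsHomogeneous.sub (hx β) ?_
    rw [Finsupp.linearCombination_apply, Finsupp.sum]
    refine isHomogeneous_sum (fun j hj => isHomogeneous_smul ?_ _) β
    have hj' : deg j = d := (Finsupp.mem_support_iff.1 hj |> fun hne => by
      by_contra hc
      exact hne (Finsupp.filter_apply_neg _ _ hc))
    exact hj' ▸ hB j
  have hy0 : y = 0 := by
    refine Subtype.ext (funext fun β => ?_)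
    rw [← homogeneousComponent_eq_self (hyd β), hy, Finsupp.linearCombination_apply, Finsupp.sum,
      AddSubmonoidClass.coe_finsetSum, Finset.sum_apply, map_sum]
    refine Finset.sum_eq_zero fun j hj => ?_
    have hj' : deg j ≠ d := fun hc =>
      Finsupp.mem_support_iff.1 hj (Finsupp.filter_apply_neg _ _ (not_not.2 hc))
    rw [homogeneousComponent_of_mem (isHomogeneous_smul (hB j) (l₂ j) β), if_neg hj'.symm]
  have hl0 : l₂ = 0 := by
    rw [← B.repr_linearCombination l₂, ← hy, hy0, map_zero]
  have := DFunLike.congr_fun hl0 i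
  exact (Finsupp.filter_apply_pos (fun i => ¬ deg i = d) (B.repr x) hi).symm.trans this

theorem sum_repr_smul_of_isHomogeneous {I : Type*} (B : Module.Basis I ℂ h.smallRing) {deg : I → ℕ}
    (hB : ∀ i, h.IsHomogeneous (deg i) (B i)) {d : ℕ} {s : Finset I} (hs : ∀ i, i ∈ s ↔ deg i = d)
    {x : h.smallRing} (hx : h.IsHomogeneous d x) : ∑ i ∈ s, B.repr x i • B i = x := by
  conv_rhs => rw [← B.linearCombination_repr x, Finsupp.linearCombination_apply]
  rw [Finsupp.sum]
  refine (Finset.sum_subset (fun i hi => ?_) fun i _ hi => ?_).symm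
  · rw [hs]
    by_contra hc
    exact Finsupp.mem_support_iff.1 hi (repr_eq_zero_of_isHomogeneous B hB hx hc)
  · rw [Finsupp.notMem_support_iff.1 hi, zero_smul]

/-- The trace of a degree-preserving endomorphism on the part of degree `d` does not depend on the
homogeneous `ℂ`-basis used to compute it. -/
theorem trace_eq_trace {I J : Type*} (B : Module.Basis I ℂ h.smallRing)
    (C : Module.Basis J ℂ h.smallRing) {degB : I → ℕ} {degC : J → ℕ}
    (hB : ∀ i, h.IsHomogeneous (degB i) (B i)) (hC : ∀ j, h.IsHomogeneous (degC j) (C j))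
    {d : ℕ} {s : Finset I} {t : Finset J} (hs : ∀ i, i ∈ s ↔ degB i = d)
    (ht : ∀ j, j ∈ t ↔ degC j = d) (f : h.smallRing →ₗ[ℂ] h.smallRing)
    (hf : ∀ x, h.IsHomogeneous d x → h.IsHomogeneous d (f x)) :
    ∑ i ∈ s, B.repr (f (B i)) i = ∑ j ∈ t, C.repr (f (C j)) j := by
  have h1 : ∀ i ∈ s, B.repr (f (B i)) i = ∑ j ∈ t, C.repr (B i) j * B.repr (f (C j)) i := by
    intro i hi
    conv_lhs =>
      rw [← sum_repr_smul_of_isHomogeneous C hC ht (x := B i) ((hs i).1 hi ▸ hB i), map_sum,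
        map_sum, Finsupp.finsetSum_apply]
    exact Finset.sum_congr rfl fun j _ => by rw [map_smul, map_smul]; rfl
  have h2 : ∀ j ∈ t, C.repr (f (C j)) j = ∑ i ∈ s, C.repr (B i) j * B.repr (f (C j)) i := by
    intro j hj
    conv_lhs =>
      rw [← sum_repr_smul_of_isHomogeneous B hB hs (x := f (C j)) (hf _ ((ht j).1 hj ▸ hC j)),
        map_sum, Finsupp.finsetSum_apply]
    exact Finset.sum_congr rfl fun i _ => by rw [map_smul, mul_comm]; rfl
  rw [Finset.sum_congr rfl h1, Finset.sum_congr rfl h2, Finset.sum_comm]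

open Classical in
/-- The generating function of the monomials fixed by a permutation of the indeterminates, by
degree. -/
noncomputable def fixedMonomialSeries (σ : Equiv.Perm (Fin n)) : PowerSeries ℂ :=
  PowerSeries.mk fun d =>
    (((Finset.univ.finsuppAntidiag d).filter fun m : Fin n →₀ ℕ => m.mapDomain σ = m).card : ℂ)

/-- The graded trace, as a polynomial in `q`. -/
noncomputable def gradedTracePoly {A : Subalgebra ℂ h.smallRing} {ι : Type*} [Fintype ι]
    (e : h.HomogeneousBasis A ι) (w : Equiv.Perm (Fin n)) : Polynomial ℂ :=
  ∑ i, Polynomial.X ^ e.deg i *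
    Polynomial.C (h.scalarPart (e.basis.repr (h.dot w (e.basis i)) i : h.smallRing))

theorem gradedTrace_eq {A : Subalgebra ℂ h.smallRing} {ι : Type*} [Fintype ι]
    (e : h.HomogeneousBasis A ι) (w : Equiv.Perm (Fin n)) :
    gradedTrace e w = algebraMap (Polynomial ℂ) (RatFunc ℂ) (gradedTracePoly e w) := by
  simp only [gradedTrace, gradedTracePoly, map_sum, map_mul, map_pow, RatFunc.algebraMap_X,
    RatFunc.algebraMap_C]

section Tower

variable {A : Subalgebra ℂ h.smallRing} {ι : Type*} (e : h.HomogeneousBasis A ι)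
  (φ : MvPolynomial (Fin n) ℂ ≃ₐ[ℂ] A)

/-- The `ℂ`-basis of `𝒯_h` formed by the products of the monomials of `A` with the elements of an
`A`-basis. -/
noncomputable def towerBasis : Module.Basis ((Fin n →₀ ℕ) × ι) ℂ h.smallRing :=
  ((basisMonomials (Fin n) ℂ).map φ.toLinearEquiv).smulTower e.basis

theorem towerBasis_apply (m : Fin n →₀ ℕ) (i : ι) :
    towerBasis e φ (m, i) = φ (monomial m 1) • e.basis i := by
  rw [towerBasis, Module.Basis.smulTower_apply, Module.Basis.map_apply, coe_basisMonomials]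
  rfl

theorem towerBasis_repr (x : h.smallRing) (m : Fin n →₀ ℕ) (i : ι) :
    (towerBasis e φ).repr x (m, i) = coeff m (φ.symm (e.basis.repr x i)) := by
  rw [towerBasis, Module.Basis.smulTower_repr]
  rfl

variable {φ} (hφ : ∀ m, h.IsHomogeneous m.degree (φ (monomial m 1) : h.smallRing))

include hφ

theorem isHomogeneous_towerBasis (mi : (Fin n →₀ ℕ) × ι) :
    h.IsHomogeneous (mi.1.degree + e.deg mi.2) (towerBasis e φ mi) := by
  intro β
  rw [← Prod.mk.eta (p := mi), towerBasis_apply]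
  exact (hφ mi.1 β).mul (e.homogeneous mi.2 β)

/-- For degree reasons, the diagonal coefficients of the dot action in a homogeneous `A`-basis are
scalars. -/
theorem symm_repr_dot_eq_C (w : Equiv.Perm (Fin n)) (i : ι) :
    φ.symm (e.basis.repr (h.dot w (e.basis i)) i) =
      C (h.scalarPart (e.basis.repr (h.dot w (e.basis i)) i : h.smallRing)) := by
  classical
  set a := e.basis.repr (h.dot w (e.basis i)) i with ha
  have h1 : φ.symm a = C (coeff 0 (φ.symm a)) := by
    ext m
    rw [coeff_C]
    split_ifs with hm
    · rw [hm]
    · rw [ha, ← towerBasis_repr]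
      refine repr_eq_zero_of_isHomogeneous _ (isHomogeneous_towerBasis e hφ)
        (isHomogeneous_dot (e.homogeneous i) w) fun hc => hm ?_
      have h2 : m.degree = 0 := by simpa using hc
      exact ((Finsupp.degree_eq_zero_iff m).1 h2).symm
  have h2 : a = algebraMap ℂ A (coeff 0 (φ.symm a)) := by
    rw [← φ.commutes, ← MvPolynomial.algebraMap_eq] at *
    rw [← h1, φ.apply_symm_apply]
  have h3 : h.scalarPart (a : h.smallRing) = coeff 0 (φ.symm a) := by
    conv_lhs => rw [h2]
    exact constantCoeff_C _ _
  rw [h3]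
  exact h1

theorem towerBasis_repr_dot {w σ : Equiv.Perm (Fin n)}
    (hσ : ∀ f, h.dot w (φ f : h.smallRing) = φ (rename σ f)) (m : Fin n →₀ ℕ) (i : ι)
    [Decidable (m.mapDomain σ = m)] :
    (towerBasis e φ).repr (h.dot w (towerBasis e φ (m, i))) (m, i) =
      if m.mapDomain σ = m then
        h.scalarPart (e.basis.repr (h.dot w (e.basis i)) i : h.smallRing) else 0 := by
  classical
  have h1 : h.dot w (towerBasis e φ (m, i)) =
      φ (rename σ (monomial m 1)) • h.dot w (e.basis i) := by
    rw [towerBasis_apply, Subalgebra.smul_def, smul_eq_mul, map_mul, hσ]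
    rfl
  have h2 : e.basis.repr (h.dot w (towerBasis e φ (m, i))) i =
      φ (rename σ (monomial m 1)) * e.basis.repr (h.dot w (e.basis i)) i := by
    rw [h1]
    exact DFunLike.congr_fun (e.basis.repr.map_smul _ _) i
  rw [towerBasis_repr, h2, map_mul, symm_repr_dot_eq_C e hφ, φ.symm_apply_apply,
    rename_monomial, mul_comm, C_mul_monomial, coeff_monomial, mul_one]
  split_ifs <;> rfl

/-- The graded trace over `A` times the graded trace on `A` is the graded trace over `ℂ`. -/
theorem coeff_gradedTracePoly_mul [Fintype ι] {w σ : Equiv.Perm (Fin n)}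
    (hσ : ∀ f, h.dot w (φ f : h.smallRing) = φ (rename σ f)) (d : ℕ)
    {s : Finset ((Fin n →₀ ℕ) × ι)} (hs : ∀ mi, mi ∈ s ↔ mi.1.degree + e.deg mi.2 = d) :
    PowerSeries.coeff d ((gradedTracePoly e w : PowerSeries ℂ) * fixedMonomialSeries σ) =
      ∑ mi ∈ s, (towerBasis e φ).repr (h.dot w (towerBasis e φ mi)) mi := by
  classical
  have h1 : ∀ mi ∈ s, (towerBasis e φ).repr (h.dot w (towerBasis e φ mi)) mi =
      if mi.1.mapDomain σ = mi.1 then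
        h.scalarPart (e.basis.repr (h.dot w (e.basis mi.2)) mi.2 : h.smallRing) else 0 :=
    fun mi _ => towerBasis_repr_dot e hφ hσ mi.1 mi.2
  have h2 : s = (Finset.univ.filter fun i => e.deg i ≤ d).biUnion fun i =>
      (Finset.univ.finsuppAntidiag (d - e.deg i)).map
        (Function.Embedding.sectL _ i) := by
    ext ⟨m, i⟩
    simp only [hs, Finset.mem_biUnion, Finset.mem_filter, Finset.mem_univ, true_and,
      Finset.mem_map, Function.Embedding.sectL_apply, Prod.mk.injEq, Finset.mem_finsuppAntidiag,
      Finset.subset_univ, and_true, ← Finsupp.degree_eq_sum]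
    constructor
    · exact fun hm => ⟨i, by omega, m, by omega, rfl, rfl⟩
    · rintro ⟨i', h3, m', h4, rfl, rfl⟩
      omega
  rw [Finset.sum_congr rfl h1, h2, Finset.sum_biUnion]
  · simp only [gradedTracePoly, ← Polynomial.coeToPowerSeries.ringHom_apply, map_sum, map_mul,
      map_pow, Finset.sum_mul]
    rw [Finset.sum_filter]
    refine Finset.sum_congr rfl fun i _ => ?_
    rw [Polynomial.coeToPowerSeries.ringHom_apply, Polynomial.coeToPowerSeries.ringHom_apply,
      Polynomial.coe_X, Polynomial.coe_C, mul_assoc, PowerSeries.coeff_X_pow_mul']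
    refine if_congr Iff.rfl ?_ rfl
    rw [PowerSeries.coeff_C_mul, fixedMonomialSeries, PowerSeries.coeff_mk, Finset.sum_map]
    simp only [Function.Embedding.sectL_apply]
    rw [← Finset.sum_filter, Finset.sum_const, nsmul_eq_mul, mul_comm]
  · intro i _ j _ hij
    rw [Function.onFun, Finset.disjoint_left]
    rintro _ hx hy
    obtain ⟨m, -, rfl⟩ := Finset.mem_map.1 hx
    obtain ⟨m', -, h3⟩ := Finset.mem_map.1 hy
    exact hij (congrArg Prod.snd h3).symm

end Tower

end HessenbergFunction

/-! ### The monomials fixed by a permutation of the indeterminates -/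

namespace HessenbergFunction

variable {n : ℕ}

theorem one_sub_X_pow_mul_mk {s : ℕ} (hs : 0 < s) :
    (1 - PowerSeries.X ^ s : PowerSeries ℂ) *
      PowerSeries.mk (fun k => if s ∣ k then (1 : ℂ) else 0) = 1 := by
  ext d
  rw [sub_mul, one_mul, map_sub, PowerSeries.coeff_X_pow_mul', PowerSeries.coeff_mk,
    PowerSeries.coeff_one]
  rcases lt_or_ge d s with hd | hd
  · rw [if_neg (not_le.2 hd), sub_zero]
    refine if_congr ⟨fun h => Nat.eq_zero_of_dvd_of_lt h hd, ?_⟩ rfl rfl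
    rintro rfl
    exact dvd_zero s
  · rw [if_pos hd, PowerSeries.coeff_mk, if_neg (by omega : d ≠ 0), sub_eq_zero]
    refine if_congr ⟨fun h => Nat.dvd_sub h dvd_rfl, fun h => ?_⟩ rfl rfl
    rw [← Nat.sub_add_cancel hd]
    exact dvd_add h dvd_rfl

/-- If a permutation `σ` has as orbits the fibres of `π`, then its fixed monomials are freely
generated by the products of the indeterminates in the orbits. -/
theorem fixedMonomialSeries_eq_prod {N : Type*} [Fintype N] [DecidableEq N]
    {σ : Equiv.Perm (Fin n)} {π : Fin n → N}
    (hσ : ∀ m : Fin n →₀ ℕ, m.mapDomain σ = m ↔ ∀ x y, π x = π y → m x = m y) {s : N → ℕ}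
    (hs : ∀ o, 0 < s o) (hcard : ∀ o, (Finset.univ.filter fun x => π x = o).card = s o) :
    fixedMonomialSeries σ =
      ∏ o, PowerSeries.mk fun k => if s o ∣ k then (1 : ℂ) else 0 := by
  classical
  have hsurj : Function.Surjective π := by
    intro o
    have h1 := hs o
    rw [← hcard, Finset.card_pos] at h1
    obtain ⟨x, hx⟩ := h1
    exact ⟨x, (Finset.mem_filter.1 hx).2⟩
  obtain ⟨r, hr⟩ := hsurj.hasRightInverse
  have hsum : ∀ f : N → ℕ, ∑ x, f (π x) = ∑ o, s o * f o := by
    intro f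
    rw [← Finset.sum_fiberwise (s := Finset.univ) (g := π)]
    refine Finset.sum_congr rfl fun o _ => ?_
    rw [← hcard, ← smul_eq_mul, ← Finset.sum_const]
    exact Finset.sum_congr rfl fun x hx => by rw [(Finset.mem_filter.1 hx).2]
  ext d
  rw [fixedMonomialSeries, PowerSeries.coeff_mk, PowerSeries.coeff_prod]
  simp only [PowerSeries.coeff_mk, Finset.prod_boole, Finset.mem_univ, forall_true_left]
  rw [Finset.sum_boole]
  congr 1
  have hfac : ∀ m : Fin n →₀ ℕ, m.mapDomain σ = m → ∀ x, m (r (π x)) = m x :=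
    fun m hm x => (hσ m).1 hm _ _ (hr _)
  refine Finset.card_nbij' (fun m => Finsupp.equivFunOnFinite.symm fun o => s o * m (r o))
    (fun l => Finsupp.equivFunOnFinite.symm fun x => l (π x) / s (π x)) ?_ ?_ ?_ ?_
  · intro m hm
    simp only [Finset.coe_filter, Set.mem_ofPred_eq, Finset.mem_finsuppAntidiag,
      Finset.subset_univ, and_true, Finsupp.coe_equivFunOnFinite_symm] at hm ⊢
    refine ⟨?_, fun o => dvd_mul_right _ _⟩
    rw [← hsum fun o => m (r o), ← hm.1]
    exact Finset.sum_congr rfl fun x _ => hfac m hm.2 x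
  · intro l hl
    simp only [Finset.coe_filter, Set.mem_ofPred_eq, Finset.mem_finsuppAntidiag,
      Finset.subset_univ, and_true, Finsupp.coe_equivFunOnFinite_symm] at hl ⊢
    refine ⟨?_, ?_⟩
    · rw [hsum fun o => l o / s o, ← hl.1]
      exact Finset.sum_congr rfl fun o _ => Nat.mul_div_cancel' (hl.2 o)
    · rw [hσ]
      intro x y hxy
      simp only [Finsupp.coe_equivFunOnFinite_symm, hxy]
  · intro m hm
    simp only [Finset.coe_filter, Set.mem_ofPred_eq] at hm
    ext x
    simp only [Finsupp.coe_equivFunOnFinite_symm]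
    rw [Nat.mul_div_cancel_left _ (hs _), hfac m hm.2]
  · intro l hl
    simp only [Finset.coe_filter, Set.mem_ofPred_eq] at hl
    ext o
    simp only [Finsupp.coe_equivFunOnFinite_symm]
    rw [hr o, Nat.mul_div_cancel' (hl.2 o)]

open Classical in
/-- The orbit of a point under a permutation: a nontrivial cycle or a fixed point. -/
noncomputable def orbitLabel (σ : Equiv.Perm (Fin n)) (x : Fin n) :
    {c // c ∈ σ.cycleFactorsFinset} ⊕ {y // y ∈ σ.supportᶜ} :=
  if hx : x ∈ σ.support then
    Sum.inl ⟨σ.cycleOf x, Equiv.Perm.cycleOf_mem_cycleFactorsFinset_iff.2 hx⟩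
  else Sum.inr ⟨x, Finset.mem_compl.2 hx⟩

theorem orbitLabel_eq_iff (σ : Equiv.Perm (Fin n)) (x y : Fin n) :
    orbitLabel σ x = orbitLabel σ y ↔ σ.SameCycle x y := by
  unfold orbitLabel
  split_ifs with hx hy hy
  · rw [Sum.inl.injEq, Subtype.mk.injEq]
    refine ⟨fun h1 => ?_, fun h1 => h1.cycleOf_eq⟩
    have h2 : y ∈ (σ.cycleOf x).support := by
      rw [h1, Equiv.Perm.mem_support_cycleOf_iff]
      exact ⟨Equiv.Perm.SameCycle.refl _ _, hy⟩
    exact (Equiv.Perm.mem_support_cycleOf_iff.1 h2).1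
  · refine ⟨fun h1 => by simp at h1, fun h1 => ?_⟩
    exact absurd ((h1.apply_eq_self_iff).2 (Equiv.Perm.notMem_support.1 hy))
      (Equiv.Perm.mem_support.1 hx)
  · refine ⟨fun h1 => by simp at h1, fun h1 => ?_⟩
    exact absurd ((h1.apply_eq_self_iff).1 (Equiv.Perm.notMem_support.1 hx))
      (Equiv.Perm.mem_support.1 hy)
  · rw [Sum.inr.injEq, Subtype.mk.injEq]
    refine ⟨fun h1 => h1 ▸ Equiv.Perm.SameCycle.refl _ _, fun h1 => ?_⟩
    obtain ⟨i, hi⟩ := h1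
    rw [← hi]
    exact (Equiv.Perm.zpow_apply_eq_self_of_apply_eq_self (Equiv.Perm.notMem_support.1 hx) i).symm

theorem mapDomain_eq_self_iff (σ : Equiv.Perm (Fin n)) (m : Fin n →₀ ℕ) :
    m.mapDomain σ = m ↔ ∀ x y, orbitLabel σ x = orbitLabel σ y → m x = m y := by
  simp only [orbitLabel_eq_iff]
  constructor
  · intro h1 x y hxy
    have h2 : ∀ x, m (σ x) = m x := by
      intro x
      conv_lhs => rw [← h1]
      exact Finsupp.mapDomain_apply σ.injective m x
    have h3 : ∀ i : ℕ, m ((σ ^ i) x) = m x := by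
      intro i
      induction i with
      | zero => rfl
      | succ i ih => rw [pow_succ', Equiv.Perm.mul_apply, h2, ih]
    obtain ⟨i, -, -, rfl⟩ := hxy.exists_pow_eq'
    exact (h3 i).symm
  · intro h1
    ext x
    obtain ⟨y, rfl⟩ := σ.surjective x
    rw [Finsupp.mapDomain_apply σ.injective]
    exact h1 y (σ y) (Equiv.Perm.SameCycle.refl σ y).apply_right

/-- The fixed monomials of a permutation have the generating function
`∏ 1 / (1 - q ^ k)`, the product being over the lengths `k` of its cycles. -/
theorem prod_mul_fixedMonomialSeries (σ : Equiv.Perm (Fin n)) :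
    (σ.partition.parts.map fun k => (1 - PowerSeries.X ^ k : PowerSeries ℂ)).prod *
      fixedMonomialSeries σ = 1 := by
  classical
  let s : {c // c ∈ σ.cycleFactorsFinset} ⊕ {y // y ∈ σ.supportᶜ} → ℕ :=
    Sum.elim (fun c => c.1.support.card) fun _ => 1
  have hs : ∀ o, 0 < s o := by
    rintro (c | y)
    · exact two_pos.trans_le
        (Equiv.Perm.mem_cycleFactorsFinset_iff.1 c.2).1.two_le_card_support
    · exact Nat.one_pos
  have hcard : ∀ o, (Finset.univ.filter fun x => orbitLabel σ x = o).card = s o := by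
    rintro (⟨c, hc⟩ | ⟨y, hy⟩)
    · change _ = c.support.card
      congr 1
      ext x
      rw [Finset.mem_filter]
      unfold orbitLabel
      split_ifs with hx
      · simp only [Finset.mem_univ, true_and, Sum.inl.injEq, Subtype.mk.injEq]
        constructor
        · rintro rfl
          exact Equiv.Perm.mem_support_cycleOf_iff.2 ⟨Equiv.Perm.SameCycle.refl _ _, hx⟩
        · exact fun h1 => (Equiv.Perm.cycle_is_cycleOf h1 hc).symm
      · simp only [Finset.mem_univ, true_and, false_iff]
        exact fun h1 => hx (Equiv.Perm.mem_cycleFactorsFinset_support_le hc h1)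
    · change _ = 1
      rw [Finset.card_eq_one]
      refine ⟨y, ?_⟩
      ext x
      rw [Finset.mem_filter, Finset.mem_singleton]
      unfold orbitLabel
      split_ifs with hx
      · simp only [Finset.mem_univ, true_and, false_iff]
        rintro rfl
        exact Finset.mem_compl.1 hy hx
      · simp
  have hparts : (σ.partition.parts.map fun k => (1 - PowerSeries.X ^ k : PowerSeries ℂ)).prod =
      ∏ o, (1 - PowerSeries.X ^ s o) := by
    rw [Equiv.Perm.parts_partition, Multiset.map_add, Multiset.prod_add, Fintype.prod_sum_type,
      Equiv.Perm.cycleType_def, Multiset.map_map]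
    congr 1
    · exact (Finset.prod_coe_sort σ.cycleFactorsFinset
        fun c => (1 - PowerSeries.X ^ c.support.card : PowerSeries ℂ)).symm
    · rw [Multiset.map_replicate, Multiset.prod_replicate]
      have h1 : ∀ o : {y // y ∈ σ.supportᶜ}, s (Sum.inr o) = 1 := fun _ => rfl
      simp only [h1]
      rw [Finset.prod_const, Finset.card_univ, Fintype.card_coe, Finset.card_compl]
  rw [hparts, fixedMonomialSeries_eq_prod (mapDomain_eq_self_iff σ) hs hcard,
    ← Finset.prod_mul_distrib]
  exact Finset.prod_eq_one fun o _ => one_sub_X_pow_mul_mk (hs o)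

end HessenbergFunction

/-! ### Comparison of the two base rings -/

theorem Multiset.prod_map_pow_eq_pow_sum {M : Type*} [CommMonoid M] (a : M) (s : Multiset ℕ) :
    (s.map fun k => a ^ k).prod = a ^ s.sum := by
  induction s using Multiset.induction_on with
  | empty => simp
  | cons k s ih => rw [map_cons, prod_cons, ih, sum_cons, pow_add]

namespace HessenbergFunction

open MvPolynomial

variable {n : ℕ} {h : HessenbergFunction n}

variable (h) in
/-- The identification of `ℂ[L]` with the polynomial ring. -/
noncomputable def leftEquiv : MvPolynomial (Fin n) ℂ ≃ₐ[ℂ] h.leftBase :=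
  AlgEquiv.ofInjective ((BigRing.leftPoly n).codRestrict h.smallRing h.leftPoly_mem)
    fun _ _ hfg => congrFun (congrArg Subtype.val hfg) 1

variable (h) in
/-- The identification of `ℂ[R]` with the polynomial ring. -/
noncomputable def rightEquiv : MvPolynomial (Fin n) ℂ ≃ₐ[ℂ] h.rightBase :=
  AlgEquiv.ofInjective ((BigRing.rightPoly n).codRestrict h.smallRing h.rightPoly_mem)
    fun _ _ hfg => rename_injective _ (1 : Equiv.Perm (Fin n)).injective
      (congrFun (congrArg Subtype.val hfg) 1)

theorem isHomogeneous_leftEquiv (m : Fin n →₀ ℕ) :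
    h.IsHomogeneous m.degree (h.leftEquiv (monomial m 1) : h.smallRing) := fun _ =>
  isHomogeneous_monomial 1 rfl

theorem isHomogeneous_rightEquiv (m : Fin n →₀ ℕ) :
    h.IsHomogeneous m.degree (h.rightEquiv (monomial m 1) : h.smallRing) := fun _ =>
  IsHomogeneous.rename_isHomogeneous (isHomogeneous_monomial 1 rfl)

/-- The dot action permutes the indeterminates of `ℂ[L]`. -/
theorem dot_leftEquiv (w : Equiv.Perm (Fin n)) (f : MvPolynomial (Fin n) ℂ) :
    h.dot w (h.leftEquiv f : h.smallRing) = h.leftEquiv (rename w f) := rfl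

/-- The dot action is trivial on `ℂ[R]`. -/
theorem dot_rightEquiv (w : Equiv.Perm (Fin n)) (f : MvPolynomial (Fin n) ℂ) :
    h.dot w (h.rightEquiv f : h.smallRing) =
      h.rightEquiv (rename (1 : Equiv.Perm (Fin n)) f) := by
  refine Subtype.ext (funext fun β => ?_)
  change rename w (rename (w⁻¹ * β) f) = rename β (rename (1 : Equiv.Perm (Fin n)) f)
  rw [rename_rename, rename_rename]
  congr 2
  ext x
  simp

theorem finite_degree_add_eq {ι : Type*} [Fintype ι] (δ : ι → ℕ) (d : ℕ) :
    {mi : (Fin n →₀ ℕ) × ι | mi.1.degree + δ mi.2 = d}.Finite := by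
  refine ((Finsupp.finite_of_degree_le d).prod Set.finite_univ).subset ?_
  rintro ⟨m, i⟩ hm
  exact ⟨Nat.le.intro hm, trivial⟩

/-- Both sides are the graded trace of `w` on the complex vector space `𝒯_h`. -/
theorem gradedTracePoly_mul_eq {ι κ : Type*} [Fintype ι] [Fintype κ]
    (b : h.HomogeneousBasis h.leftBase ι) (c : h.HomogeneousBasis h.rightBase κ)
    (w : Equiv.Perm (Fin n)) :
    (gradedTracePoly b w : PowerSeries ℂ) * fixedMonomialSeries w =
      (gradedTracePoly c w : PowerSeries ℂ) * fixedMonomialSeries (1 : Equiv.Perm (Fin n)) := by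
  ext d
  rw [coeff_gradedTracePoly_mul b isHomogeneous_leftEquiv (dot_leftEquiv w) d
      (s := (finite_degree_add_eq b.deg d).toFinset) (fun _ => Set.Finite.mem_toFinset _),
    coeff_gradedTracePoly_mul c isHomogeneous_rightEquiv (dot_rightEquiv w) d
      (s := (finite_degree_add_eq c.deg d).toFinset) (fun _ => Set.Finite.mem_toFinset _)]
  exact trace_eq_trace _ _ (isHomogeneous_towerBasis b isHomogeneous_leftEquiv)
    (isHomogeneous_towerBasis c isHomogeneous_rightEquiv) (fun _ => Set.Finite.mem_toFinset _)
    (fun _ => Set.Finite.mem_toFinset _) (h.dot w).toLinearMap fun x hx => isHomogeneous_dot hx w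

theorem gradedTrace_mul_eq {ι κ : Type*} [Fintype ι] [Fintype κ]
    (b : h.HomogeneousBasis h.leftBase ι) (c : h.HomogeneousBasis h.rightBase κ)
    (w : Equiv.Perm (Fin n)) :
    gradedTrace b w * (w.partition.parts.map fun k => (1 - RatFunc.X) ^ k).prod =
      gradedTrace c w * (w.partition.parts.map fun k => 1 - RatFunc.X ^ k).prod := by
  let P : Equiv.Perm (Fin n) → Polynomial ℂ := fun σ =>
    (σ.partition.parts.map fun k => 1 - Polynomial.X ^ k).prod
  have hP : ∀ σ, (P σ : PowerSeries ℂ) * fixedMonomialSeries σ = 1 := by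
    intro σ
    rw [← prod_mul_fixedMonomialSeries σ, ← Polynomial.coeToPowerSeries.ringHom_apply,
      map_multiset_prod, Multiset.map_map]
    simp [Function.comp_def]
  have h1 : P 1 = (w.partition.parts.map fun k => (1 - Polynomial.X) ^ k).prod := by
    rw [Multiset.prod_map_pow_eq_pow_sum, w.partition.parts_sum]
    simp [P, Equiv.Perm.parts_partition]
  have h2 : gradedTracePoly b w * P 1 = gradedTracePoly c w * P w := by
    refine Polynomial.coe_injective ℂ ?_
    rw [Polynomial.coe_mul, Polynomial.coe_mul]
    linear_combination ((P 1 : PowerSeries ℂ) * (P w : PowerSeries ℂ)) *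
      gradedTracePoly_mul_eq b c w + (gradedTracePoly c w : PowerSeries ℂ) * P w * hP 1 -
      (gradedTracePoly b w : PowerSeries ℂ) * P 1 * hP w
  have h3 := congrArg (algebraMap (Polynomial ℂ) (RatFunc ℂ)) h2
  rw [map_mul, map_mul, ← gradedTrace_eq, ← gradedTrace_eq, h1] at h3
  simpa [P, map_multiset_prod, Multiset.map_map, Function.comp_def] using h3

end HessenbergFunction

theorem mainTheorem10 {n : ℕ} (h : HessenbergFunction n) :
    -- `𝒯_h` is free over `ℂ[L]` and over `ℂ[R]`, with homogeneous bases of `n!` elements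
    Nonempty (h.HomogeneousBasis h.leftBase (Fin n.factorial)) ∧
    Nonempty (h.HomogeneousBasis h.rightBase (Fin n.factorial)) ∧
    -- `id * (S ∘ E_q)` is a Hopf endomorphism sending `p_(k)` to `(1 - q ^ k) p_(k)`
    (∃ Φ : SymFun (RatFunc ℂ) →ₐc[RatFunc ℂ] SymFun (RatFunc ℂ),
      (∀ f, Φ f = idConvAntipodeEulerian f) ∧
      ∀ k : ℕ, 1 ≤ k →
        Φ (SymFun.p (RatFunc ℂ) k) = (1 - RatFunc.X ^ k : RatFunc ℂ) • SymFun.p (RatFunc ℂ) k) ∧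
    -- the change of base ring, whichever homogeneous bases are used to compute the two sides
    ∀ (ι κ : Type*) [Fintype ι] [Fintype κ] (b : h.HomogeneousBasis h.leftBase ι)
      (c : h.HomogeneousBasis h.rightBase κ),
      SymFun.eulerian (1 - RatFunc.X) (HessenbergFunction.frob b) =
        idConvAntipodeEulerian (HessenbergFunction.frob c) ∧
      HessenbergFunction.frob b =
        SymFun.scale (fun k : ℕ => (1 - RatFunc.X ^ k) / (1 - RatFunc.X) ^ k)
          (HessenbergFunction.frob c) := by
  refine ⟨HessenbergFunction.nonempty_homogeneousBasis HessenbergFunction.isDiagonal_leftBase,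
    HessenbergFunction.nonempty_homogeneousBasis HessenbergFunction.isDiagonal_rightBase,
    ⟨SymFun.scale fun k : ℕ => 1 - RatFunc.X ^ k, scale_eq_idConvAntipodeEulerian,
      fun k hk => SymFun.scale_p _ hk⟩, fun ι κ _ _ b c => ⟨?_, ?_⟩⟩
  · rw [← scale_eq_idConvAntipodeEulerian, SymFun.eulerian, HessenbergFunction.scale_frob,
      HessenbergFunction.scale_frob]
    simp only [HessenbergFunction.gradedTrace_mul_eq b c]
  · have hX : (1 - RatFunc.X : RatFunc ℂ) ≠ 0 := by
      rw [← RatFunc.algebraMap_X, ← map_one (algebraMap (Polynomial ℂ) (RatFunc ℂ)), ← map_sub]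
      refine RatFunc.algebraMap_ne_zero fun h1 => ?_
      have := congrArg (Polynomial.eval 0) h1
      simp at this
    rw [HessenbergFunction.scale_frob, HessenbergFunction.frob]
    congr 1
    refine Finset.sum_congr rfl fun w _ => ?_
    congr 1
    have h1 : (w.partition.parts.map fun k : ℕ => (1 - RatFunc.X : RatFunc ℂ) ^ k).prod ≠ 0 := by
      rw [Multiset.prod_map_pow_eq_pow_sum]
      exact pow_ne_zero _ hX
    rw [Multiset.prod_map_div, ← mul_div_assoc, eq_div_iff h1,
      HessenbergFunction.gradedTrace_mul_eq b c]
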